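/- A \emph{tile} is a unit cube centered at a point (\emph{position}) of $\mathbb{Z}^3$; two positions are \emph{adjacent} if they are at Euclidean distance $1$. A \emph{polycube} is a finite nonempty set $P\subset\mathbb{Z}^3$ of positions whose induced grid graph is connected. It is \emph{non-degenerate} if any two tiles of $P$ that share an edge but not a face (i.e. whose positions differ by exactly $1$ in exactly two coordinates and agree in the third) have a common neighbor in $P$ (a tile of $P$ adjacent to both). For $c\in\mathbb{N}$, the \emph{$c$-scaled copy} $P^c$ is obtained by replacing every tile of $P$ by a $c\times c\times c$ cube of tiles. \emph{Single step model.} A shape with $n$ tiles is assembled in the workspace $\{0,\dots,2n-1\}^3$, which initially contains a single fixed seed tile at $(n,n,n)$. A further tile can move, inside the workspace, from a position $p$ to an adjacent position $q$ if $p$ and all positions adjacent to $p$ are free, i.e. not occupied by the tiles placed so far. A \emph{construction step} moves one new tile by a finite sequence of such moves from $(0,0,0)$ to a free position that is adjacent to an occupied position, where it is then fixed. A polycube with $n$ tiles is \emph{constructible} if a translate of it is obtained from the seed tile by successive construction steps. \textbf{Theorem.} For every non-degenerate polycube $P$, its $3$-scaled copy $P^3$ is constructible. -/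

import Mathlib

namespace TiltAssembly

/-- Grid positions of `ℤ³`; a tile is the unit cube centered at a position. -/
abbrev Pos := Fin 3 → ℤ

/-- The `ℓ¹`-distance of two positions. -/
def dist1 (p q : Pos) : ℤ := ∑ i, |p i - q i|

/-- The grid graph on `ℤ³`: positions at unit distance are adjacent
(equivalently, the two unit cubes share a face). -/
def grid : SimpleGraph Pos where
  Adj p q := dist1 p q = 1
  symm := ⟨fun p q h => by
    have : dist1 q p = dist1 p q := Finset.sum_congr rfl fun i _ => abs_sub_comm _ _
    exact this.trans h⟩
  loopless := ⟨fun p h => by simp [dist1] at h⟩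

/-- A finite set of positions is a polycube if the grid graph induced by it is connected
(in particular, it is nonempty). -/
def IsPolycube (P : Finset Pos) : Prop := (grid.induce (P : Set Pos)).Connected

/-- The unit cubes at `p` and `q` share an edge but not a face: they have a common point,
and their positions differ in exactly two coordinates. -/
def ShareEdge (p q : Pos) : Prop := (∀ i, |p i - q i| ≤ 1) ∧ dist1 p q = 2

/-- `P` is non-degenerate if any two of its tiles that share an edge but not a face have a
common neighbor in `P`. (For tiles that share a face, or only a vertex, there is no position at
all that is adjacent to both, so the edge-sharing pairs are the ones for which the condition
makes sense.) -/
def NonDegenerate (P : Finset Pos) : Prop :=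
  ∀ t₁ ∈ P, ∀ t₂ ∈ P, ShareEdge t₁ t₂ → ∃ t ∈ P, grid.Adj t₁ t ∧ grid.Adj t₂ t

/-- The `c`-scaled copy of `P`: each tile is replaced by a `c × c × c` cube of tiles. -/
noncomputable def scaledCopy (c : ℕ) (P : Finset Pos) : Finset Pos :=
  P.biUnion fun p => Fintype.piFinset fun i => Finset.Ico (c * p i) (c * p i + c)

/-- The workspace for shapes with `n` tiles: `2n × 2n × 2n` positions, anchored at `(0,0,0)`. -/
def workspace (n : ℕ) : Set Pos := {p | ∀ i, 0 ≤ p i ∧ p i < 2 * n}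

/-- The position `(n,n,n)` of the seed tile. -/
def seed (n : ℕ) : Pos := fun _ => n

/-- A single tile moves from `p` to the adjacent position `q`, within the workspace, while the
tiles at the positions of `A` are fixed; this requires that all neighbors of `p` are free
(otherwise the tile at `p` sticks to an adjacent tile). -/
def Move (n : ℕ) (A : Finset Pos) (p q : Pos) : Prop :=
  p ∈ workspace n ∧ q ∈ workspace n ∧ grid.Adj p q ∧ p ∉ A ∧ ∀ r, grid.Adj p r → r ∉ A

/-- A construction step: a sequence of moves brings a tile from `(0,0,0)` to the free position
`p`, which is adjacent to an occupied position. -/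
def ConstructionStep (n : ℕ) (A : Finset Pos) (p : Pos) : Prop :=
  Relation.ReflTransGen (Move n A) 0 p ∧ p ∉ A ∧ ∃ r ∈ A, grid.Adj p r

/-- The sets of tiles that are obtained from the seed tile by successive construction steps in
the workspace for `n` tiles. -/
inductive Assembled (n : ℕ) : Finset Pos → Prop
  | seed : Assembled n {seed n}
  | step {A : Finset Pos} {p : Pos} :
      Assembled n A → ConstructionStep n A p → Assembled n (insert p A)

/-- A shape `P` with `n` tiles is constructible if, in the workspace for `n` tiles, some
construction sequence that begins with the seed tile results in (a translate of) `P`. -/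
def Constructible (P : Finset Pos) : Prop :=
  ∃ v : Pos, Assembled P.card (P.image fun p => p + v)

end TiltAssembly

/-! The members of `P` are treated as cells, each to be filled by a 3×3×3 cube of tiles. The shape
grows level by level in the last coordinate from a lowest cell, and every tile arrives through the
cell above its own. A cell of the current level `J` is begun with a few tiles of its bottom layer
and counts as blocked from then on (`exists_insert`). Cells below `J` that are connected to the
built part only through level `J` hang below a neighbor `t` of some begun cell `s`. Once `s` is
begun and while `t` is still free, two tiles bridge from `s` to `t`, and the hanging component is
built upside down from its top cell, by recursion (`exists_child`). When level `J` is closed under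
adjacency, its cells are filled (`fill`, `succ`); `solvable` combines these steps.

Non-degeneracy enters twice: different components below level `J` do not even share an edge
(`not_near`), and a pending cell near `s` does hang below a neighbor of `s` (`exists_hanging`). Thus
the set being built is near other blocked cells in at most two places, one below and one above its
levels.

That the cell above is reachable from the corner `b` is a topological fact. Let `K` be the blocked
part and `O` the region reachable from `b`. Signed crossings of the interface of `O` and `K` form a
1-cochain. It is closed away from the at most two pinch points, and after a correction at these
points it has a potential `N` (`exists_potential`). `N` is 0 on `O`, and near-connectedness makes it
-1 on all of `K`. A position next to `K` but not in `O` would also have value -1, whereas `N`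
vanishes on any position whose ray in the first coordinate misses `K`. So such positions next to `K`
are free (`mem_free`), for instance those above a topmost cell of `K`.

Scale 3 leaves room for a path through the centers of free cells, even if bridge tiles remain at the
middle of some of their edges (`reach_center`). -/

set_option linter.unusedSimpArgs false

namespace TiltAssembly

/-! ### Coordinates -/

/-- The position with the given coordinates. -/
def pt (a b c : ℤ) : Pos := ![a, b, c]

@[simp] theorem pt_zero (a b c : ℤ) : pt a b c 0 = a := rfl
@[simp] theorem pt_one (a b c : ℤ) : pt a b c 1 = b := rfl
@[simp] theorem pt_two (a b c : ℤ) : pt a b c 2 = c := rfl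

theorem pos_ext {p q : Pos} (h₀ : p 0 = q 0) (h₁ : p 1 = q 1) (h₂ : p 2 = q 2) : p = q := by
  funext i
  fin_cases i <;> assumption

theorem pt_eta (p : Pos) : pt (p 0) (p 1) (p 2) = p := pos_ext rfl rfl rfl

theorem dist1_eq (p q : Pos) : dist1 p q = |p 0 - q 0| + |p 1 - q 1| + |p 2 - q 2| := by
  simp [dist1, Fin.sum_univ_three]

theorem adj_iff {p q : Pos} : grid.Adj p q ↔
    (q 0 = p 0 + 1 ∧ q 1 = p 1 ∧ q 2 = p 2) ∨ (q 0 = p 0 - 1 ∧ q 1 = p 1 ∧ q 2 = p 2) ∨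
    (q 0 = p 0 ∧ q 1 = p 1 + 1 ∧ q 2 = p 2) ∨ (q 0 = p 0 ∧ q 1 = p 1 - 1 ∧ q 2 = p 2) ∨
    (q 0 = p 0 ∧ q 1 = p 1 ∧ q 2 = p 2 + 1) ∨ (q 0 = p 0 ∧ q 1 = p 1 ∧ q 2 = p 2 - 1) := by
  change dist1 p q = 1 ↔ _
  rw [dist1_eq]
  constructor
  · intro h
    rcases abs_cases (p 0 - q 0) with h0 | h0 <;> rcases abs_cases (p 1 - q 1) with h1 | h1 <;>
      rcases abs_cases (p 2 - q 2) with h2 | h2 <;> omega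
  · rintro (h | h | h | h | h | h) <;> obtain ⟨h0, h1, h2⟩ := h <;> simp [h0, h1, h2]

/-- Two positions are near if their unit cubes share at least an edge. -/
def Near (p q : Pos) : Prop :=
  (p 0 - 1 ≤ q 0 ∧ q 0 ≤ p 0 + 1) ∧ (p 1 - 1 ≤ q 1 ∧ q 1 ≤ p 1 + 1) ∧
  (p 2 - 1 ≤ q 2 ∧ q 2 ≤ p 2 + 1) ∧ (p 0 = q 0 ∨ p 1 = q 1 ∨ p 2 = q 2)

theorem Near.refl (p : Pos) : Near p p := by unfold Near; omega

theorem Near.symm {p q : Pos} (h : Near p q) : Near q p := by unfold Near at *; omega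

theorem near_of_adj {p q : Pos} (h : grid.Adj p q) : Near p q := by
  rw [adj_iff] at h; unfold Near; omega

theorem Near.shareEdge {p q : Pos} (h : Near p q) (hne : p ≠ q) (ha : ¬ grid.Adj p q) :
    ShareEdge p q := by
  have hne' : ¬ (p 0 = q 0 ∧ p 1 = q 1 ∧ p 2 = q 2) := fun h => hne (pos_ext h.1 h.2.1 h.2.2)
  have ha' : dist1 p q ≠ 1 := ha
  rw [dist1_eq] at ha'
  obtain ⟨h0, h1, h2, h3⟩ := h
  have a0 : |p 0 - q 0| ≤ 1 := abs_le.2 ⟨by omega, by omega⟩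
  have a1 : |p 1 - q 1| ≤ 1 := abs_le.2 ⟨by omega, by omega⟩
  have a2 : |p 2 - q 2| ≤ 1 := abs_le.2 ⟨by omega, by omega⟩
  refine ⟨fun i => by fin_cases i <;> assumption, ?_⟩
  rw [dist1_eq]
  have z : ∀ x y : ℤ, |x - y| = 0 ↔ x = y := fun x y => by rw [abs_eq_zero, sub_eq_zero]
  have z0 := z (p 0) (q 0)
  have z1 := z (p 1) (q 1)
  have z2 := z (p 2) (q 2)
  have n0 := abs_nonneg (p 0 - q 0)
  have n1 := abs_nonneg (p 1 - q 1)
  have n2 := abs_nonneg (p 2 - q 2)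
  generalize |p 0 - q 0| = a at *
  generalize |p 1 - q 1| = b at *
  generalize |p 2 - q 2| = c at *
  omega

/-- Near tiles of a non-degenerate shape that are different and not adjacent have a common
neighbor in the shape. -/
theorem NonDegenerate.exists_adj {P : Finset Pos} (hP : NonDegenerate P) {p q : Pos} (hp : p ∈ P)
    (hq : q ∈ P) (h : Near p q) (hne : p ≠ q) (ha : ¬ grid.Adj p q) :
    ∃ t ∈ P, grid.Adj p t ∧ grid.Adj q t :=
  hP p hp q hq (h.shareEdge hne ha)

/-! ### A discrete potential -/

open Classical in
/-- Crossing number of the step from `a` to `b` with respect to the interface of `O` and `K`. -/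
noncomputable def crossing (O K : Set Pos) (a b : Pos) : ℤ :=
  (if a ∈ O then 1 else 0) * (if b ∈ K then 1 else 0) -
    (if a ∈ K then 1 else 0) * (if b ∈ O then 1 else 0)

theorem crossing_symm (O K : Set Pos) (a b : Pos) : crossing O K b a = - crossing O K a b := by
  unfold crossing; ring

theorem crossing_eq_zero {O K : Set Pos} {a b : Pos} (ha : a ∉ K) (hb : b ∉ K) :
    crossing O K a b = 0 := by
  simp [crossing, ha, hb]

theorem crossing_eq_zero_left {O K : Set Pos} {a b : Pos} (ha : a ∉ K) (hb : a ∉ O) :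
    crossing O K a b = 0 := by
  simp [crossing, ha, hb]

theorem crossing_eq_zero_right {O K : Set Pos} {a b : Pos} (ha : b ∉ K) (hb : b ∉ O) :
    crossing O K a b = 0 := by
  simp [crossing, ha, hb]

/-- `K` is a part of the set `Q` of obstacles with levels between `lo` and `hi`, separated from the
rest of `Q` up to at most two positions `V`, one below and one above these levels; `O` is an open
part of the complement of `Q`. -/
structure Pinched (O K V Q : Set Pos) (lo hi : ℤ) : Prop where
  le : lo ≤ hi
  disj : ∀ e ∈ O, e ∉ Q
  sub : K ⊆ Q
  subV : V ⊆ Q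
  closed : ∀ e ∈ O, ∀ e', grid.Adj e e' → e' ∉ Q → ∀ k ∈ K, Near k e' → e' ∈ O
  sep : ∀ k ∈ K, ∀ q ∈ Q, Near k q → q ∈ K ∨ q ∈ V
  level : ∀ k ∈ K, lo ≤ k 2 ∧ k 2 ≤ hi
  levelV : ∀ v ∈ V, v 2 = lo - 1 ∨ v 2 = hi + 1
  unique : ∀ v ∈ V, ∀ v' ∈ V, v 2 = v' 2 → v = v'

namespace Pinched

variable {O K V Q : Set Pos} {lo hi : ℤ}

theorem notMem_K (h : Pinched O K V Q lo hi) {v : Pos} (hv : v ∈ V) : v ∉ K := fun hk => by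
  have := h.level v hk
  have := h.levelV v hv
  omega

theorem notMem_of_level (h : Pinched O K V Q lo hi) {v : Pos} (hv : v 2 < lo ∨ hi < v 2) :
    v ∉ K := fun hk => by
  have := h.level v hk
  omega

theorem crossing_of_mem (h : Pinched O K V Q lo hi) {v b : Pos} (hv : v ∈ V) :
    crossing O K v b = 0 :=
  crossing_eq_zero_left (h.notMem_K hv) fun ho => h.disj v ho (h.subV hv)

theorem crossing_of_mem' (h : Pinched O K V Q lo hi) {v b : Pos} (hv : v ∈ V) :
    crossing O K b v = 0 :=
  crossing_eq_zero_right (h.notMem_K hv) fun ho => h.disj v ho (h.subV hv)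

-- Near `K`, a position in neither `K` nor `V` is outside `Q` by `sep`, and `closed` makes
-- membership in `O` constant along an edge between two such positions. Hence the cochain is locally
-- the coboundary of the indicator of `O`.
open Classical in
theorem crossing_edge (h : Pinched O K V Q lo hi) {a b k : Pos} (hk : k ∈ K) (ha : Near k a)
    (hb : Near k b) (hab : grid.Adj a b) (hav : a ∉ V) (hbv : b ∉ V) :
    crossing O K a b = (if a ∈ O then 1 else 0) - (if b ∈ O then 1 else 0) := by
  have hK : ∀ x ∈ K, x ∉ O := fun x hx ho => h.disj x ho (h.sub hx)
  have hn : ∀ x, Near k x → x ∉ V → x ∉ K → x ∉ Q := fun x hx hv hxk hq =>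
    (h.sep k hk x hq hx).elim hxk hv
  unfold crossing
  by_cases haK : a ∈ K <;> by_cases hbK : b ∈ K
  · simp [haK, hbK, hK a haK, hK b hbK]
  · simp [haK, hbK, hK a haK]
  · simp [haK, hbK, hK b hbK]
  · have : a ∈ O ↔ b ∈ O :=
      ⟨fun ho => h.closed a ho b hab (hn b hb hbv hbK) k hk hb,
        fun ho => h.closed b ho a hab.symm (hn a ha hav haK) k hk ha⟩
    simp [haK, hbK, this]

/-- The crossing numbers around a unit square that does not meet `V` cancel. -/
theorem crossing_square (h : Pinched O K V Q lo hi) {a b c d : Pos} (hab : grid.Adj a b)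
    (hbc : grid.Adj b c) (hcd : grid.Adj c d) (hda : grid.Adj d a) (hac : Near a c)
    (hbd : Near b d) (ha : a ∉ V) (hb : b ∉ V) (hc : c ∉ V) (hd : d ∉ V) :
    crossing O K a b + crossing O K b c + crossing O K c d + crossing O K d a = 0 := by
  -- If one vertex is in `K`, all four are near it and the differences telescope; otherwise all
  -- terms vanish.
  have key : ∀ k ∈ K, Near k a → Near k b → Near k c → Near k d →
      crossing O K a b + crossing O K b c + crossing O K c d + crossing O K d a = 0 := by
    intro k hk na nb nc nd
    rw [h.crossing_edge hk na nb hab ha hb, h.crossing_edge hk nb nc hbc hb hc,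
      h.crossing_edge hk nc nd hcd hc hd, h.crossing_edge hk nd na hda hd ha]
    ring
  by_cases hka : a ∈ K
  · exact key a hka (.refl _) (near_of_adj hab) hac (near_of_adj hda).symm
  by_cases hkb : b ∈ K
  · exact key b hkb (near_of_adj hab).symm (.refl _) (near_of_adj hbc) hbd
  by_cases hkc : c ∈ K
  · exact key c hkc hac.symm (near_of_adj hbc).symm (.refl _) (near_of_adj hcd)
  by_cases hkd : d ∈ K
  · exact key d hkd (near_of_adj hda) hbd.symm (near_of_adj hcd).symm (.refl _)
  simp [crossing_eq_zero, hka, hkb, hkc, hkd]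

/-- The jump across the edge from `v = (x, y, z)` to `(x, y, z + e)`, computed along the way
through `(x + i, y + j, z)`. -/
noncomputable def jump (O K : Set Pos) (x y z e i j : ℤ) : ℤ :=
  crossing O K (pt (x + i) (y + j) z) (pt (x + i) (y + j) (z + e)) +
    crossing O K (pt (x + i) (y + j) (z + e)) (pt x y (z + e))

/-- In the unit cube with corner `v`, add up the three faces that do not contain `v`. Edges at the
level of `v` contribute nothing, since `K` does not reach that level. -/
theorem jump_corner (h : Pinched O K V Q lo hi) {x y z e i j : ℤ} (hv : pt x y z ∈ V)
    (he : e = 1 ∨ e = -1) (hi' : i = 1 ∨ i = -1) (hj : j = 1 ∨ j = -1)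
    (hz : z < lo ∨ hi < z) (hze : lo ≤ z + e ∧ z + e ≤ hi) :
    jump O K x y z e i 0 = jump O K x y z e 0 j := by
  have hV : ∀ a b c : ℤ, (c = z ∧ (a ≠ x ∨ b ≠ y)) ∨ c = z + e → pt a b c ∉ V := by
    intro a b c hc hm
    rcases hc with hc | hc
    · have := h.unique _ hm _ hv (by simpa using hc.1)
      have h0 := congrFun this 0
      have h1 := congrFun this 1
      simp at h0 h1
      omega
    · have := h.levelV _ hm
      simp at this
      omega
  have h0 : ∀ a b a' b' : ℤ, crossing O K (pt a b z) (pt a' b' z) = 0 := fun a b a' b' =>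
    crossing_eq_zero (h.notMem_of_level (by simpa using hz)) (h.notMem_of_level (by simpa using hz))
  have s₁ := h.crossing_square (a := pt (x + i) y z) (b := pt (x + i) (y + j) z)
    (c := pt (x + i) (y + j) (z + e)) (d := pt (x + i) y (z + e))
    (by simp [adj_iff]; omega) (by simp [adj_iff]; omega) (by simp [adj_iff]; omega)
    (by simp [adj_iff]; omega) (by simp [Near]; omega) (by simp [Near]; omega)
    (hV _ _ _ (by omega)) (hV _ _ _ (by omega)) (hV _ _ _ (by omega)) (hV _ _ _ (by omega))
  have s₂ := h.crossing_square (a := pt x (y + j) z) (b := pt (x + i) (y + j) z)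
    (c := pt (x + i) (y + j) (z + e)) (d := pt x (y + j) (z + e))
    (by simp [adj_iff]; omega) (by simp [adj_iff]; omega) (by simp [adj_iff]; omega)
    (by simp [adj_iff]; omega) (by simp [Near]; omega) (by simp [Near]; omega)
    (hV _ _ _ (by omega)) (hV _ _ _ (by omega)) (hV _ _ _ (by omega)) (hV _ _ _ (by omega))
  have s₃ := h.crossing_square (a := pt x y (z + e)) (b := pt (x + i) y (z + e))
    (c := pt (x + i) (y + j) (z + e)) (d := pt x (y + j) (z + e))
    (by simp [adj_iff]; omega) (by simp [adj_iff]; omega) (by simp [adj_iff]; omega)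
    (by simp [adj_iff]; omega) (by simp [Near]; omega) (by simp [Near]; omega)
    (hV _ _ _ (by omega)) (hV _ _ _ (by omega)) (hV _ _ _ (by omega)) (hV _ _ _ (by omega))
  rw [h0] at s₁ s₂
  have c₁ := crossing_symm O K (pt (x + i) y z) (pt (x + i) y (z + e))
  have c₂ := crossing_symm O K (pt x (y + j) z) (pt x (y + j) (z + e))
  have c₃ := crossing_symm O K (pt x y (z + e)) (pt (x + i) y (z + e))
  have c₄ := crossing_symm O K (pt (x + i) (y + j) (z + e)) (pt (x + i) y (z + e))
  simp only [jump, add_zero]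
  linarith

theorem jump_opposite (h : Pinched O K V Q lo hi) {x y z e : ℤ} (hv : pt x y z ∈ V)
    (he : e = 1 ∨ e = -1) (hz : z < lo ∨ hi < z) (hze : lo ≤ z + e ∧ z + e ≤ hi) :
    jump O K x y z e 1 0 = jump O K x y z e (-1) 0 := by
  rw [h.jump_corner hv he (.inl rfl) (.inl rfl) hz hze,
    h.jump_corner hv he (.inr rfl) (.inl rfl) hz hze]

open Classical in
/-- The correction of the crossing number on the edge from `(x, y, z)` to `(x, y, z + 1)`. -/
noncomputable def correction (O K V : Set Pos) (lo hi x y z : ℤ) : ℤ :=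
  if pt x y z ∈ V ∧ z = lo - 1 then jump O K x y z 1 1 0
  else if pt x y (z + 1) ∈ V ∧ z = hi then - jump O K x y (z + 1) (-1) 1 0 else 0

theorem correction_eq_zero {x y z : ℤ} (h₁ : pt x y z ∈ V → z ≠ lo - 1)
    (h₂ : pt x y (z + 1) ∈ V → z ≠ hi) : correction O K V lo hi x y z = 0 := by
  unfold correction
  rw [if_neg fun h => h₁ h.1 h.2, if_neg fun h => h₂ h.1 h.2]

theorem correction_below {x y z : ℤ} (h₁ : pt x y z ∈ V) (h₂ : z = lo - 1) :
    correction O K V lo hi x y z = jump O K x y z 1 1 0 :=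
  if_pos ⟨h₁, h₂⟩

theorem correction_above {x y z : ℤ} (h₁ : pt x y (z + 1) ∈ V) (h₂ : z = hi) (hle : lo ≤ hi) :
    correction O K V lo hi x y z = - jump O K x y (z + 1) (-1) 1 0 := by
  unfold correction
  rw [if_neg (by omega), if_pos ⟨h₁, h₂⟩]

/-- The sum of the crossing numbers along the ray in the direction of the first coordinate. -/
noncomputable def potential (O K : Set Pos) (X x y z : ℤ) : ℤ :=
  ∑ i ∈ Finset.Ico x X, crossing O K (pt i y z) (pt (i + 1) y z)

theorem potential_succ (O K : Set Pos) {X x : ℤ} (y z : ℤ) (hx : x < X) :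
    potential O K X x y z =
      crossing O K (pt x y z) (pt (x + 1) y z) + potential O K X (x + 1) y z := by
  unfold potential
  rw [← Finset.insert_Ico_add_one_left_eq_Ico hx, Finset.sum_insert (by simp)]

theorem potential_of_le (O K : Set Pos) {X x : ℤ} (y z : ℤ) (hx : X ≤ x) :
    potential O K X x y z = 0 := by
  unfold potential
  rw [Finset.Ico_eq_empty (by omega), Finset.sum_empty]

/-- The squares between the two rays telescope. No correction is needed: a level that meets `V`
contains no `K`, so each horizontal square avoids `V` or has only zero crossings. -/
theorem potential_y (h : Pinched O K V Q lo hi) {X : ℤ} (hX : ∀ k ∈ K, k 0 < X) (n : ℕ) :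
    ∀ x y z : ℤ, X - x ≤ n → potential O K X x y z - potential O K X x (y + 1) z =
      crossing O K (pt x y z) (pt x (y + 1) z) := by
  have hXK : ∀ x y z : ℤ, X ≤ x → pt x y z ∉ K := fun x y z hx hk => by
    have := hX _ hk
    simp at this
    omega
  induction n with
  | zero =>
    intro x y z hx
    rw [potential_of_le _ _ _ _ (by omega), potential_of_le _ _ _ _ (by omega),
      crossing_eq_zero (hXK _ _ _ (by omega)) (hXK _ _ _ (by omega)), sub_zero]
  | succ n ih =>
    intro x y z hx
    by_cases hx' : X ≤ x
    · exact ih x y z (by omega)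
    rw [potential_succ O K y z (not_le.1 hx'), potential_succ O K (y + 1) z (not_le.1 hx')]
    have h1 := ih (x + 1) y z (by push_cast at hx; omega)
    by_cases hz : z < lo ∨ hi < z
    · have h0 : ∀ a b a' b' : ℤ, crossing O K (pt a b z) (pt a' b' z) = 0 := fun a b a' b' =>
        crossing_eq_zero (h.notMem_of_level (by simpa using hz))
          (h.notMem_of_level (by simpa using hz))
      rw [h0] at h1
      rw [h0, h0, h0]
      linarith
    · have hV : ∀ a b : ℤ, pt a b z ∉ V := fun a b hm => by
        have := h.levelV _ hm
        simp at this
        omega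
      have s := h.crossing_square (a := pt x y z) (b := pt (x + 1) y z)
        (c := pt (x + 1) (y + 1) z) (d := pt x (y + 1) z)
        (by simp [adj_iff]) (by simp [adj_iff]) (by simp [adj_iff])
        (by simp [adj_iff]) (by simp [Near]; omega) (by simp [Near]; omega)
        (hV _ _) (hV _ _) (hV _ _) (hV _ _)
      have c₁ := crossing_symm O K (pt x (y + 1) z) (pt (x + 1) (y + 1) z)
      have c₂ := crossing_symm O K (pt x (y + 1) z) (pt x y z)
      linarith

/-- Only squares with `z = lo - 1` or `z = hi` can contain both a point of `V` and nonzero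
crossings, and by `unique` they contain just one such point. The correction supplies the missing
value on its vertical edge; `jump_opposite` lets the same value serve the squares on both sides. -/
theorem crossing_square_corrected (h : Pinched O K V Q lo hi) (x y z : ℤ) :
    crossing O K (pt x y z) (pt (x + 1) y z) +
      (crossing O K (pt (x + 1) y z) (pt (x + 1) y (z + 1)) +
        correction O K V lo hi (x + 1) y z) =
    crossing O K (pt x y (z + 1)) (pt (x + 1) y (z + 1)) +
      (crossing O K (pt x y z) (pt x y (z + 1)) + correction O K V lo hi x y z) := by
  have hle := h.le
  have h0 : ∀ a b a' b' c : ℤ, c < lo ∨ hi < c → crossing O K (pt a b c) (pt a' b' c) = 0 :=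
    fun a b a' b' c hc => crossing_eq_zero (h.notMem_of_level (by simpa using hc))
      (h.notMem_of_level (by simpa using hc))
  have h0' : ∀ a b a' b' c : ℤ, (c < lo ∨ hi < c) → (c + 1 < lo ∨ hi < c + 1) →
      crossing O K (pt a b c) (pt a' b' (c + 1)) = 0 :=
    fun a b a' b' c hc hc' => crossing_eq_zero (h.notMem_of_level (by simpa using hc))
      (h.notMem_of_level (by simpa using hc'))
  have hVl : ∀ a b c : ℤ, pt a b c ∈ V → c = lo - 1 ∨ c = hi + 1 := fun a b c hm => by
    simpa using h.levelV _ hm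
  have hVu : ∀ a b a' b' c : ℤ, pt a b c ∈ V → pt a' b' c ∈ V → a = a' := fun a b a' b' c hm hm' =>
    by simpa using congrFun (h.unique _ hm _ hm' rfl) 0
  have plain : pt x y z ∉ V → pt (x + 1) y z ∉ V → pt (x + 1) y (z + 1) ∉ V →
      pt x y (z + 1) ∉ V → crossing O K (pt x y z) (pt (x + 1) y z) +
        crossing O K (pt (x + 1) y z) (pt (x + 1) y (z + 1)) =
      crossing O K (pt x y (z + 1)) (pt (x + 1) y (z + 1)) +
        crossing O K (pt x y z) (pt x y (z + 1)) := by
    intro v₁ v₂ v₃ v₄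
    have s := h.crossing_square (a := pt x y z) (b := pt (x + 1) y z)
        (c := pt (x + 1) y (z + 1)) (d := pt x y (z + 1))
        (by simp [adj_iff]) (by simp [adj_iff]) (by simp [adj_iff])
        (by simp [adj_iff]) (by simp [Near]; omega) (by simp [Near]; omega) v₁ v₂ v₃ v₄
    have c₁ := crossing_symm O K (pt x y (z + 1)) (pt (x + 1) y (z + 1))
    have c₂ := crossing_symm O K (pt x y z) (pt x y (z + 1))
    linarith
  by_cases hz₁ : z = lo - 1
  · have v₃ : pt (x + 1) y (z + 1) ∉ V := fun hm => by have := hVl _ _ _ hm; omega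
    have v₄ : pt x y (z + 1) ∉ V := fun hm => by have := hVl _ _ _ hm; omega
    by_cases v₁ : pt x y z ∈ V
    · have v₂ : pt (x + 1) y z ∉ V := fun hm => by have := hVu _ _ _ _ _ v₁ hm; omega
      rw [correction_eq_zero (absurd · v₂) (absurd · v₃), correction_below v₁ hz₁,
        h.crossing_of_mem v₁, h.crossing_of_mem v₁]
      have c₁ := crossing_symm O K (pt x y (z + 1)) (pt (x + 1) y (z + 1))
      simp only [jump, add_zero]
      linarith
    · rw [correction_eq_zero (absurd · v₁) (absurd · v₄)]
      by_cases v₂ : pt (x + 1) y z ∈ V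
      · rw [correction_below v₂ hz₁, h.jump_opposite v₂ (.inl rfl) (by omega) (by omega),
          h.crossing_of_mem v₂, h.crossing_of_mem' v₂]
        simp only [jump, add_zero, add_neg_cancel_right]
        linarith
      · rw [correction_eq_zero (absurd · v₂) (absurd · v₃)]
        linarith [plain v₁ v₂ v₃ v₄]
  by_cases hz₂ : z = hi
  · have v₁ : pt x y z ∉ V := fun hm => by have := hVl _ _ _ hm; omega
    have v₂ : pt (x + 1) y z ∉ V := fun hm => by have := hVl _ _ _ hm; omega
    by_cases v₄ : pt x y (z + 1) ∈ V
    · have v₃ : pt (x + 1) y (z + 1) ∉ V := fun hm => by have := hVu _ _ _ _ _ v₄ hm; omega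
      rw [correction_eq_zero (absurd · v₂) (absurd · v₃), correction_above v₄ hz₂ hle,
        h.crossing_of_mem v₄, h.crossing_of_mem' v₄]
      have c₁ := crossing_symm O K (pt x y z) (pt (x + 1) y z)
      have c₂ := crossing_symm O K (pt (x + 1) y z) (pt (x + 1) y (z + 1))
      simp only [jump, add_zero, add_neg_cancel_right]
      linarith
    · rw [correction_eq_zero (absurd · v₁) (absurd · v₄)]
      by_cases v₃ : pt (x + 1) y (z + 1) ∈ V
      · rw [correction_above v₃ hz₂ hle, h.jump_opposite v₃ (.inr rfl) (by omega) (by omega),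
          h.crossing_of_mem' v₃, h.crossing_of_mem' v₃]
        have c₂ := crossing_symm O K (pt x y z) (pt x y (z + 1))
        simp only [jump, add_zero, add_neg_cancel_right]
        linarith
      · rw [correction_eq_zero (absurd · v₂) (absurd · v₃)]
        linarith [plain v₁ v₂ v₃ v₄]
  rw [correction_eq_zero (fun _ => hz₁) fun _ => hz₂,
    correction_eq_zero (fun _ => hz₁) fun _ => hz₂]
  by_cases hz : z < lo ∨ hi < z
  · rw [h0 _ _ _ _ z hz, h0 _ _ _ _ (z + 1) (by omega), h0' _ _ _ _ z hz (by omega),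
      h0' _ _ _ _ z hz (by omega)]
  · linarith [plain (fun hm => by have := hVl _ _ _ hm; omega)
      (fun hm => by have := hVl _ _ _ hm; omega) (fun hm => by have := hVl _ _ _ hm; omega)
      (fun hm => by have := hVl _ _ _ hm; omega)]

theorem potential_z (h : Pinched O K V Q lo hi) {X : ℤ} (hX : ∀ k ∈ K, k 0 < X)
    (hXV : ∀ v ∈ V, v 0 + 1 < X) (n : ℕ) :
    ∀ x y z : ℤ, X - x ≤ n → potential O K X x y z - potential O K X x y (z + 1) =
      crossing O K (pt x y z) (pt x y (z + 1)) + correction O K V lo hi x y z := by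
  have hXK : ∀ x y z : ℤ, X ≤ x → pt x y z ∉ K := fun x y z hx hk => by
    have := hX _ hk
    simp at this
    omega
  have hXV' : ∀ x y z : ℤ, X ≤ x → pt x y z ∉ V := fun x y z hx hk => by
    have := hXV _ hk
    simp at this
    omega
  induction n with
  | zero =>
    intro x y z hx
    simp [potential_of_le O K (X := X) (x := x) _ _ (by omega), correction,
      crossing_eq_zero (hXK x y z (by omega)) (hXK x y (z + 1) (by omega)),
      hXV' x y _ (show X ≤ x by omega)]
  | succ n ih =>
    intro x y z hx
    by_cases hx' : X ≤ x
    · exact ih x y z (by omega)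
    rw [potential_succ O K y z (not_le.1 hx'), potential_succ O K y (z + 1) (not_le.1 hx')]
    have h1 := ih (x + 1) y z (by push_cast at hx; omega)
    have := h.crossing_square_corrected x y z
    linarith

/-- There is a potential whose differences are the crossing numbers. -/
theorem exists_potential (h : Pinched O K V Q lo hi) (hQ : Q.Finite) :
    ∃ N : Pos → ℤ, (∀ a b, grid.Adj a b → a ∉ V → b ∉ V → N a - N b = crossing O K a b) ∧
      ∀ c, (∀ j : ℤ, c 0 ≤ j → pt j (c 1) (c 2) ∉ K) → N c = 0 := by
  obtain ⟨X, hX⟩ : ∃ X : ℤ, ∀ q ∈ Q, q 0 < X := by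
    obtain ⟨B, hB⟩ := (hQ.image fun q : Pos => q 0).bddAbove
    exact ⟨B + 1, fun q hq => by have := hB ⟨q, hq, rfl⟩; simp at this; omega⟩
  have hXK : ∀ k ∈ K, k 0 < X + 1 := fun k hk => by have := hX k (h.sub hk); omega
  have hXV : ∀ v ∈ V, v 0 + 1 < X + 1 := fun k hk => by have := hX k (h.subV hk); omega
  refine ⟨fun c => potential O K (X + 1) (c 0) (c 1) (c 2), ?_, ?_⟩
  · have fwd : ∀ a b : Pos, a ∉ V → b ∉ V →
        ((b 0 = a 0 + 1 ∧ b 1 = a 1 ∧ b 2 = a 2) ∨ (b 0 = a 0 ∧ b 1 = a 1 + 1 ∧ b 2 = a 2) ∨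
          (b 0 = a 0 ∧ b 1 = a 1 ∧ b 2 = a 2 + 1)) →
        potential O K (X + 1) (a 0) (a 1) (a 2) - potential O K (X + 1) (b 0) (b 1) (b 2) =
          crossing O K a b := by
      intro a b ha hb hab
      obtain ⟨x, y, z, rfl⟩ : ∃ x y z, a = pt x y z := ⟨_, _, _, (pt_eta a).symm⟩
      simp only [pt_zero, pt_one, pt_two] at hab ⊢
      rcases hab with ⟨h0, h1, h2⟩ | ⟨h0, h1, h2⟩ | ⟨h0, h1, h2⟩
      · obtain rfl : b = pt (x + 1) y z := pos_ext h0 h1 h2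
        by_cases hx : x < X + 1
        · rw [potential_succ O K y z hx]; simp
        · have hK : ∀ j, X + 1 ≤ j → pt j y z ∉ K := fun j hj hk => by
            have := hXK _ hk
            simp at this
            omega
          simp only [pt_zero, pt_one, pt_two]
          rw [potential_of_le O K y z (not_lt.1 hx), potential_of_le O K y z (by omega),
            crossing_eq_zero (hK _ (by omega)) (hK _ (by omega)), sub_zero]
      · obtain rfl : b = pt x (y + 1) z := pos_ext h0 h1 h2
        exact h.potential_y hXK (X + 1 - x).toNat _ _ _ (by omega)
      · obtain rfl : b = pt x y (z + 1) := pos_ext h0 h1 h2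
        have := h.potential_z hXK hXV (X + 1 - x).toNat x y z (by omega)
        -- The corrections live on edges that end in `V`, which the claim excludes.
        rwa [correction_eq_zero (absurd · ha) (absurd · hb), add_zero] at this
    intro a b hab ha hb
    rw [adj_iff] at hab
    have bwd := fwd b a hb ha
    rw [crossing_symm] at bwd
    rcases hab with hab | hab | hab | hab | hab | hab
    · exact fwd a b ha hb (.inl hab)
    · linarith [bwd (.inl (by omega))]
    · exact fwd a b ha hb (.inr (.inl hab))
    · linarith [bwd (.inr (.inl (by omega)))]
    · exact fwd a b ha hb (.inr (.inr hab))
    · linarith [bwd (.inr (.inr (by omega)))]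
  · intro c hc
    refine Finset.sum_eq_zero fun i hi => crossing_eq_zero (hc _ ?_) (hc _ ?_)
    · exact (Finset.mem_Ico.1 hi).1
    · have := (Finset.mem_Ico.1 hi).1
      omega

end Pinched

/-! ### Free positions at the surface of a near-connected obstacle -/

theorem crossing_eq_zero_both {O K : Set Pos} {a b : Pos} (ha : a ∈ K) (hb : b ∈ K)
    (h : ∀ c ∈ K, c ∉ O) : crossing O K a b = 0 := by
  simp [crossing, ha, hb, h a ha, h b hb]

/-- A set of positions is near-connected if it is connected with respect to `Near`. -/
def NearConn (K : Set Pos) : Prop :=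
  ∀ a ∈ K, ∀ b ∈ K, Relation.ReflTransGen (fun x y => y ∈ K ∧ Near x y) a b

/-- The positions that are reachable from `b` inside `B` outside of `Q`. -/
def Free (B : Set Pos) (b : Pos) (Q : Set Pos) : Set Pos :=
  {c | Relation.ReflTransGen (fun x y => grid.Adj x y ∧ y ∈ B ∧ y ∉ Q) b c}

theorem Free.step {B : Set Pos} {b : Pos} {Q : Set Pos} {c d : Pos} (hc : c ∈ Free B b Q)
    (h : grid.Adj c d) (hB : d ∈ B) (hQ : d ∉ Q) : d ∈ Free B b Q :=
  Relation.ReflTransGen.tail hc ⟨h, hB, hQ⟩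

theorem Free.mem_box {B : Set Pos} {b : Pos} {Q : Set Pos} {c : Pos} (hb : b ∈ B)
    (hc : c ∈ Free B b Q) : c ∈ B := by
  rcases Relation.ReflTransGen.cases_tail hc with rfl | ⟨_, _, h⟩
  · exact hb
  · exact h.2.1

theorem Free.notMem {B : Set Pos} {b : Pos} {Q : Set Pos} {c : Pos} (hb : b ∉ Q)
    (hc : c ∈ Free B b Q) : c ∉ Q := by
  rcases Relation.ReflTransGen.cases_tail hc with rfl | ⟨_, _, h⟩
  · exact hb
  · exact h.2.2

theorem Near.cases {p q : Pos} (h : Near p q) (hne : p ≠ q) (ha : ¬ grid.Adj p q) :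
    (p 0 = q 0 ∧ (q 1 = p 1 + 1 ∨ q 1 = p 1 - 1) ∧ (q 2 = p 2 + 1 ∨ q 2 = p 2 - 1)) ∨
    (p 1 = q 1 ∧ (q 0 = p 0 + 1 ∨ q 0 = p 0 - 1) ∧ (q 2 = p 2 + 1 ∨ q 2 = p 2 - 1)) ∨
    (p 2 = q 2 ∧ (q 0 = p 0 + 1 ∨ q 0 = p 0 - 1) ∧ (q 1 = p 1 + 1 ∨ q 1 = p 1 - 1)) := by
  obtain ⟨h0, h1, h2, h3⟩ := h
  have e0 : q 0 = p 0 ∨ q 0 = p 0 + 1 ∨ q 0 = p 0 - 1 := by omega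
  have e1 : q 1 = p 1 ∨ q 1 = p 1 + 1 ∨ q 1 = p 1 - 1 := by omega
  have e2 : q 2 = p 2 ∨ q 2 = p 2 + 1 ∨ q 2 = p 2 - 1 := by omega
  clear h0 h1 h2
  by_contra hcon
  by_cases d0 : q 0 = p 0 <;> by_cases d1 : q 1 = p 1 <;> by_cases d2 : q 2 = p 2
  · exact hne (pos_ext d0.symm d1.symm d2.symm)
  all_goals first | omega | (refine ha (adj_iff.2 ?_); clear hcon ha hne; omega)

/-- Near positions that are different and not adjacent have two common neighbors. -/
theorem Near.exists_common {p q : Pos} (h : Near p q) (hne : p ≠ q) (ha : ¬ grid.Adj p q) :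
    ∃ c c' : Pos, c ≠ c' ∧ grid.Adj c p ∧ grid.Adj c q ∧ grid.Adj c' p ∧ grid.Adj c' q ∧
      (c 2 = c' 2 ∨ c 2 = c' 2 + 1 ∨ c 2 = c' 2 - 1) := by
  have key : ∀ c c' : Pos, (c 0 ≠ c' 0 ∨ c 1 ≠ c' 1 ∨ c 2 ≠ c' 2) → c ≠ c' := by
    rintro c _ hc rfl
    simp at hc
  rcases h.cases hne ha with ⟨h0, h1, h2⟩ | ⟨h0, h1, h2⟩ | ⟨h0, h1, h2⟩
  · refine ⟨pt (p 0) (q 1) (p 2), pt (p 0) (p 1) (q 2), key _ _ ?_, ?_, ?_, ?_, ?_, ?_⟩ <;>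
      simp [adj_iff] <;> omega
  · refine ⟨pt (q 0) (p 1) (p 2), pt (p 0) (p 1) (q 2), key _ _ ?_, ?_, ?_, ?_, ?_, ?_⟩ <;>
      simp [adj_iff] <;> omega
  · refine ⟨pt (q 0) (p 1) (p 2), pt (p 0) (q 1) (p 2), key _ _ ?_, ?_, ?_, ?_, ?_, ?_⟩ <;>
      simp [adj_iff] <;> omega

namespace Pinched

variable {K V Q B : Set Pos} {b : Pos} {lo hi : ℤ}

/-- The ray of `b` misses `K` and free paths cross nothing, so the potential is 0 on the free
region. The contact of `k` and `e` gives -1 at `k`, and this value spreads along `Near` steps in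
`K`. -/
theorem exists_separating (h : Pinched (Free B b Q) K V Q lo hi) (hQ : Q.Finite)
    (hb : ∀ j : ℤ, pt j (b 1) (b 2) ∉ K) (hK : NearConn K) {k e : Pos} (hk : k ∈ K)
    (he : e ∈ Free B b Q) (hke : grid.Adj k e) :
    ∃ N : Pos → ℤ,
      (∀ a b', grid.Adj a b' → a ∉ V → b' ∉ V → N a - N b' = crossing (Free B b Q) K a b') ∧
      (∀ c, (∀ j : ℤ, c 0 ≤ j → pt j (c 1) (c 2) ∉ K) → N c = 0) ∧ ∀ c ∈ K, N c = -1 := by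
  classical
  obtain ⟨N, hN, hN0⟩ := h.exists_potential hQ
  have hOK : ∀ c ∈ Free B b Q, c ∉ K := fun c hc hk => h.disj c hc (h.sub hk)
  have hOV : ∀ c ∈ Free B b Q, c ∉ V := fun c hc hk => h.disj c hc (h.subV hk)
  have hO : ∀ c ∈ Free B b Q, N c = 0 := by
    intro c hc
    induction hc with
    | refl => exact hN0 b fun j _ => hb j
    | @tail x y hx hxy ih =>
      have hy : y ∈ Free B b Q := Free.step hx hxy.1 hxy.2.1 hxy.2.2
      have := hN x y hxy.1 (hOV x hx) (hOV y hy)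
      rw [crossing_eq_zero (hOK x hx) (hOK y hy)] at this
      linarith
  have hkk : N k = -1 := by
    have := hN k e hke (fun hv => h.notMem_K hv hk) (hOV e he)
    have hkO : k ∉ Free B b Q := fun ho => hOK k ho hk
    simp only [crossing, hk, he, hkO, hOK e he, if_true, if_false, hO e he] at this
    linarith
  have cross : ∀ c x, c ∉ V → x ∈ K → grid.Adj c x →
      N x = N c - if c ∈ Free B b Q then 1 else 0 := by
    intro c x hc hx hcx
    have := hN c x hcx hc (fun hv => h.notMem_K hv hx)
    have hxO : x ∉ Free B b Q := fun ho => hOK x ho hx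
    by_cases hcO : c ∈ Free B b Q
    · simp only [crossing, hx, hcO, hxO, hOK c hcO, if_true, if_false] at this
      simp only [hcO, if_true]
      linarith
    · simp only [crossing, hx, hcO, hxO, if_true, if_false] at this
      simp only [hcO, if_false]
      linarith
  have common : ∀ c x y, c ∉ V → x ∈ K → y ∈ K → grid.Adj c x → grid.Adj c y → N x = N y := by
    intro c x y hc hx hy hcx hcy
    rw [cross c x hc hx hcx, cross c y hc hy hcy]
  -- Two different points of `V` differ in level by at least 2, but the two common neighbors by at
  -- most 1, so one of these avoids `V`.
  have two : ∀ c c' x y, x ∈ K → y ∈ K → grid.Adj c x → grid.Adj c y → grid.Adj c' x →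
      grid.Adj c' y → c ≠ c' → (c 2 = c' 2 ∨ c 2 = c' 2 + 1 ∨ c 2 = c' 2 - 1) → N x = N y := by
    intro c c' x y hx hy h1 h2 h3 h4 hne hl
    by_cases hc : c ∈ V
    · refine common c' x y (fun hc' => ?_) hx hy h3 h4
      have := h.le
      have := h.levelV c hc
      have := h.levelV c' hc'
      exact hne (h.unique c hc c' hc' (by omega))
    · exact common c x y hc hx hy h1 h2
  refine ⟨N, hN, hN0, fun c hc => ?_⟩
  have hconn := hK k hk c hc
  clear hc
  suffices ∀ c, Relation.ReflTransGen (fun x y => y ∈ K ∧ Near x y) k c → c ∈ K ∧ N c = -1 from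
    (this c hconn).2
  intro c hc
  induction hc with
  | refl => exact ⟨hk, hkk⟩
  | @tail x y _ hxy ih =>
    obtain ⟨hx, hNx⟩ := ih
    obtain ⟨hy, hn⟩ := hxy
    refine ⟨hy, ?_⟩
    rw [← hNx]
    by_cases hxy : x = y
    · rw [hxy]
    by_cases hadj : grid.Adj x y
    · have := hN x y hadj (fun hv => h.notMem_K hv hx) (fun hv => h.notMem_K hv hy)
      rw [crossing_eq_zero_both hx hy fun c hc ho => hOK c ho hc] at this
      linarith
    obtain ⟨c, c', hne, h1, h2, h3, h4, hl⟩ := hn.exists_common hxy hadj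
    exact (two c c' x y hx hy h1 h2 h3 h4 hne hl).symm

/-- A position next to `K` is free if its ray in the direction of the first coordinate avoids
`K`. -/
theorem mem_free (h : Pinched (Free B b Q) K V Q lo hi) (hQ : Q.Finite)
    (hb : ∀ j : ℤ, pt j (b 1) (b 2) ∉ K) (hK : NearConn K) {k e : Pos} (hk : k ∈ K)
    (he : e ∈ Free B b Q) (hke : grid.Adj k e) {c k' : Pos} (hk' : k' ∈ K) (hc : grid.Adj k' c)
    (hcQ : c ∉ Q) (hray : ∀ j : ℤ, pt j (c 1) (c 2) ∉ K) : c ∈ Free B b Q := by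
  obtain ⟨N, hN, hN0, hNK⟩ := h.exists_separating hQ hb hK hk he hke
  by_contra hcO
  have := hN k' c hc (fun hv => h.notMem_K hv hk') (fun hv => hcQ (h.subV hv))
  rw [hNK k' hk', hN0 c fun j _ => hray j,
    crossing_eq_zero_right (fun hck => hcQ (h.sub hck)) hcO] at this
  omega

/-- A position next to `K` is free if it has a neighbor whose ray avoids `K`. -/
theorem mem_free' (h : Pinched (Free B b Q) K V Q lo hi) (hQ : Q.Finite)
    (hb : ∀ j : ℤ, pt j (b 1) (b 2) ∉ K) (hK : NearConn K) {k e : Pos} (hk : k ∈ K)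
    (he : e ∈ Free B b Q) (hke : grid.Adj k e) {c d k' : Pos} (hk' : k' ∈ K) (hc : grid.Adj k' c)
    (hcQ : c ∉ Q) (hcd : grid.Adj c d) (hd : d ∉ V) (hray : ∀ j : ℤ, pt j (d 1) (d 2) ∉ K) :
    c ∈ Free B b Q := by
  obtain ⟨N, hN, hN0, hNK⟩ := h.exists_separating hQ hb hK hk he hke
  have hcK : c ∉ K := fun hck => hcQ (h.sub hck)
  have hcV : c ∉ V := fun hv => hcQ (h.subV hv)
  have hdK : d ∉ K := by simpa [pt_eta] using hray (d 0)
  by_contra hcO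
  have h1 := hN k' c hc (fun hv => h.notMem_K hv hk') hcV
  have h2 := hN c d hcd hcV hd
  rw [hNK k' hk', crossing_eq_zero_right hcK hcO] at h1
  rw [hN0 d fun j _ => hray j, crossing_eq_zero hcK hdK] at h2
  omega

end Pinched

/-! ### Cells and tiles -/

/-- The tile at `p` belongs to the `3 × 3 × 3` cube of the cell `c`, with center `3c`. -/
def InCell (p c : Pos) : Prop :=
  (3 * c 0 - 1 ≤ p 0 ∧ p 0 ≤ 3 * c 0 + 1) ∧ (3 * c 1 - 1 ≤ p 1 ∧ p 1 ≤ 3 * c 1 + 1) ∧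
  (3 * c 2 - 1 ≤ p 2 ∧ p 2 ≤ 3 * c 2 + 1)

theorem InCell.unique {p c d : Pos} (h : InCell p c) (h' : InCell p d) : c = d := by
  unfold InCell at *
  exact pos_ext (by omega) (by omega) (by omega)

/-- The set of all tiles of the cells of `C`. -/
noncomputable def tiles (C : Finset Pos) : Finset Pos :=
  C.biUnion fun c => Fintype.piFinset fun i => Finset.Icc (3 * c i - 1) (3 * c i + 1)

theorem mem_tiles {C : Finset Pos} {p : Pos} : p ∈ tiles C ↔ ∃ c ∈ C, InCell p c := by
  simp [tiles, InCell, Fin.forall_fin_succ]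

/-- The `ℓ¹`-distance of `p` and `q` is at most `n`. -/
def Within (n : ℤ) (p q : Pos) : Prop :=
  p 0 - q 0 + (p 1 - q 1) + (p 2 - q 2) ≤ n ∧ p 0 - q 0 + (p 1 - q 1) - (p 2 - q 2) ≤ n ∧
  p 0 - q 0 - (p 1 - q 1) + (p 2 - q 2) ≤ n ∧ p 0 - q 0 - (p 1 - q 1) - (p 2 - q 2) ≤ n ∧
  -(p 0 - q 0) + (p 1 - q 1) + (p 2 - q 2) ≤ n ∧ -(p 0 - q 0) + (p 1 - q 1) - (p 2 - q 2) ≤ n ∧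
  -(p 0 - q 0) - (p 1 - q 1) + (p 2 - q 2) ≤ n ∧ -(p 0 - q 0) - (p 1 - q 1) - (p 2 - q 2) ≤ n

theorem within_of_adj {p q : Pos} (h : grid.Adj p q) : Within 1 p q := by
  rw [adj_iff] at h
  unfold Within
  rcases h with h | h | h | h | h | h <;> obtain ⟨h0, h1, h2⟩ := h <;> rw [h0, h1, h2] <;> omega

theorem within_self (p : Pos) : Within 1 p p := by unfold Within; omega

/-- No tile of `A` is at `p` or adjacent to `p`. -/
def Clear (A : Finset Pos) (p : Pos) : Prop := ∀ r ∈ A, ¬ Within 1 p r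

/-- A move of a tile inside `W`. -/
def CMove (W : Set Pos) (A : Finset Pos) (p q : Pos) : Prop :=
  p ∈ W ∧ q ∈ W ∧ grid.Adj p q ∧ p ∉ A ∧ ∀ r, grid.Adj p r → r ∉ A

theorem Clear.move {W : Set Pos} {A : Finset Pos} {p q : Pos} (h : Clear A p) (hp : p ∈ W)
    (hq : q ∈ W) (hpq : grid.Adj p q) : CMove W A p q :=
  ⟨hp, hq, hpq, fun hA => h p hA (within_self p), fun r hr hA => h r hA (within_of_adj hr)⟩

/-- The tile in the center of a cell. -/
def center (c : Pos) : Pos := pt (3 * c 0) (3 * c 1) (3 * c 2)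

/-- A tile that starts in the center of the cell `b` can be fixed at `p`. -/
def AddStep (W : Set Pos) (b : Pos) (A : Finset Pos) (p : Pos) : Prop :=
  Relation.ReflTransGen (CMove W A) (center b) p ∧ p ∉ A ∧ ∃ r ∈ A, grid.Adj p r

/-- The shape `A'` is obtained from `A` by adding tiles that start in the center of `b`. -/
def Builds (W : Set Pos) (b : Pos) : Finset Pos → Finset Pos → Prop :=
  Relation.ReflTransGen fun A A' => ∃ p, AddStep W b A p ∧ A' = insert p A

/-- The tiles of `A` outside of the cells in `Q` are tiles at the middle of an edge of a cell two of
whose adjacent sides (one of them horizontal, the other one vertical) are blocked by `Q`. -/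
def Filleted (A : Finset Pos) (Q : Set Pos) : Prop :=
  ∀ a ∈ A, ∀ c, InCell a c → c ∈ Q ∨ ∃ e x y : ℤ, (e = 1 ∨ e = -1) ∧
    ((x = 1 ∨ x = -1) ∧ y = 0 ∨ x = 0 ∧ (y = 1 ∨ y = -1)) ∧
    a = pt (3 * c 0 + x) (3 * c 1 + y) (3 * c 2 + e) ∧ pt (c 0 + x) (c 1 + y) (c 2) ∈ Q ∧
    pt (c 0) (c 1) (c 2 + e) ∈ Q

theorem Filleted.mono {A : Finset Pos} {Q Q' : Set Pos} (h : Filleted A Q) (hQ : Q ⊆ Q') :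
    Filleted A Q' := by
  intro a ha c hc
  rcases h a ha c hc with h | ⟨e, x, y, he, hxy, hac, h1, h2⟩
  · exact .inl (hQ h)
  · exact .inr ⟨e, x, y, he, hxy, hac, hQ h1, hQ h2⟩

/-- A tile at the middle of an edge has distance 2 from the center. -/
theorem Filleted.clear_center {A : Finset Pos} {Q : Set Pos} (h : Filleted A Q) {c : Pos}
    (hc : c ∉ Q) : Clear A (center c) := by
  intro r hr hw
  have hrc : InCell r c := by
    simp only [Within, center, InCell, pt_zero, pt_one, pt_two] at *; omega
  rcases h r hr c hrc with h | ⟨e, x, y, he, hxy, rfl, h1, h2⟩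
  · exact hc h
  · simp only [Within, center, pt_zero, pt_one, pt_two] at *
    omega

/-- A tile at the middle of an edge of `c` touches only the middles of the two sides at that edge,
and these lead to blocked cells; `d` is not one of them. -/
theorem Filleted.clear_side {A : Finset Pos} {Q : Set Pos} (h : Filleted A Q) {c d : Pos}
    (hc : c ∉ Q) (hd : d ∉ Q) (hcd : grid.Adj c d) :
    Clear A (pt (2 * c 0 + d 0) (2 * c 1 + d 1) (2 * c 2 + d 2)) := by
  intro r hr hw
  rw [adj_iff] at hcd
  have hrc : InCell r c ∨ InCell r d := by
    simp only [Within, InCell, pt_zero, pt_one, pt_two] at *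
    rcases hcd with hcd | hcd | hcd | hcd | hcd | hcd <;> omega
  rcases hrc with hrc | hrc
  · rcases h r hr c hrc with h | ⟨e, x, y, he, hxy, rfl, h1, h2⟩
    · exact hc h
    simp only [Within, pt_zero, pt_one, pt_two] at hw
    have : d = pt (c 0 + x) (c 1 + y) (c 2) ∨ d = pt (c 0) (c 1) (c 2 + e) := by
      rcases hcd with hcd | hcd | hcd | hcd | hcd | hcd <;>
      first
      | (left; apply pos_ext <;> simp only [pt_zero, pt_one, pt_two] <;> omega)
      | (right; apply pos_ext <;> simp only [pt_zero, pt_one, pt_two] <;> omega)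
    rcases this with rfl | rfl
    · exact hd h1
    · exact hd h2
  · rcases h r hr d hrc with h | ⟨e, x, y, he, hxy, rfl, h1, h2⟩
    · exact hd h
    simp only [Within, pt_zero, pt_one, pt_two] at hw
    rcases hcd with hcd | hcd | hcd | hcd | hcd | hcd <;> omega

section

variable {W B : Set Pos} {b : Pos} {A : Finset Pos} {Q : Set Pos}

/-- Adjacent free cells are joined by three moves along the line through their centers. -/
theorem Filleted.reach_center (h : Filleted A Q) (hBW : ∀ c ∈ B, ∀ p, InCell p c → p ∈ W)
    (hbB : b ∈ B) (hbQ : b ∉ Q) {c : Pos} (hc : c ∈ Free B b Q) :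
    Relation.ReflTransGen (CMove W A) (center b) (center c) := by
  induction hc with
  | refl => exact .refl
  | @tail c d hc hcd ih =>
    obtain ⟨hadj, hdB, hdQ⟩ := hcd
    have hcQ : c ∉ Q := Free.notMem hbQ hc
    have hcB : c ∈ B := Free.mem_box hbB hc
    have hadj' := adj_iff.1 hadj
    have w1 : center c ∈ W := hBW c hcB _ (by
      simp only [InCell, center, pt_zero, pt_one, pt_two]; omega)
    have w2 : pt (2 * c 0 + d 0) (2 * c 1 + d 1) (2 * c 2 + d 2) ∈ W :=
      hBW c hcB _ (by simp only [InCell, pt_zero, pt_one, pt_two]; omega)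
    have w3 : pt (2 * d 0 + c 0) (2 * d 1 + c 1) (2 * d 2 + c 2) ∈ W :=
      hBW d hdB _ (by simp only [InCell, pt_zero, pt_one, pt_two]; omega)
    have w4 : center d ∈ W := hBW d hdB _ (by
      simp only [InCell, center, pt_zero, pt_one, pt_two]; omega)
    refine ((ih.tail ((h.clear_center hcQ).move w1 w2 ?_)).tail
      ((h.clear_side hcQ hdQ hadj).move w2 w3 ?_)).tail
      ((h.clear_side hdQ hcQ hadj.symm).move w3 w4 ?_) <;>
    · simp only [adj_iff, center, pt_zero, pt_one, pt_two, true_and, and_true]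
      rcases hadj' with hcd | hcd | hcd | hcd | hcd | hcd <;> omega

/-- A tile can be fixed at `p` in the cell `c` if the next cell `d` in the direction `ε` of the
last coordinate is free, and so is the way from `d` to `p`. -/
theorem Filleted.addStep (h : Filleted A Q) (hBW : ∀ c ∈ B, ∀ p, InCell p c → p ∈ W)
    (hbB : b ∈ B) (hbQ : b ∉ Q) {ε : ℤ} (hε : ε = 1 ∨ ε = -1) {c p : Pos} (hcB : c ∈ B)
    (hd : pt (c 0) (c 1) (c 2 + ε) ∈ Free B b Q) (hpc : InCell p c)
    (hclear : ∀ z, 3 * c 2 - 1 ≤ z → z ≤ 3 * c 2 + 1 → ε * p 2 < ε * z →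
      Clear A (pt (p 0) (p 1) z))
    (hclear' : ∀ x y, (x = p 0 ∧ y = p 1) ∨ (y = 3 * c 1 ∧ (x = 3 * c 0 ∨ x = p 0)) →
      Clear A (pt x y (3 * c 2 + 2 * ε)))
    (hpA : p ∉ A) (hadj : ∃ r ∈ A, grid.Adj p r) : AddStep W b A p := by
  refine ⟨?_, hpA, hadj⟩
  have hdB := Free.mem_box hbB hd
  have hpW : p ∈ W := hBW c hcB p hpc
  have hcen := h.clear_center (Free.notMem hbQ hd)
  have h0 := h.reach_center hBW hbB hbQ hd
  set d := pt (c 0) (c 1) (c 2 + ε) with hddef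
  obtain ⟨⟨x1, x2⟩, ⟨y1, y2⟩, z1, z2⟩ := hpc
  have up : ∀ x y : ℤ, (x = p 0 ∧ y = p 1) ∨ (y = 3 * c 1 ∧ (x = 3 * c 0 ∨ x = p 0)) →
      Clear A (pt x y (3 * c 2 + 2 * ε)) ∧ pt x y (3 * c 2 + 2 * ε) ∈ W := by
    intro x y hxy
    have : InCell (pt x y (3 * c 2 + 2 * ε)) d := by
      simp only [hddef, InCell, pt_zero, pt_one, pt_two]; omega
    exact ⟨hclear' _ _ hxy, hBW d hdB _ this⟩
  have down : ∀ z : ℤ, 3 * c 2 - 1 ≤ z → z ≤ 3 * c 2 + 1 → ε * p 2 < ε * z →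
      Clear A (pt (p 0) (p 1) z) ∧ pt (p 0) (p 1) z ∈ W := by
    intro z h1 h2 h3
    have : InCell (pt (p 0) (p 1) z) c := by
      simp only [InCell, pt_zero, pt_one, pt_two] at *; omega
    exact ⟨hclear _ h1 h2 h3, hBW c hcB _ this⟩
  have s1 : Relation.ReflTransGen (CMove W A) (center b)
      (pt (3 * c 0) (3 * c 1) (3 * c 2 + 2 * ε)) := by
    refine h0.tail (hcen.move (hBW d hdB _ ?_) (up _ _ ?_).2 ?_)
    · simp only [InCell, center, pt_zero, pt_one, pt_two]; omega
    any_goals omega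
    simp only [adj_iff, center, hddef, pt_zero, pt_one, pt_two, true_and, and_true]; omega
  have s2 : Relation.ReflTransGen (CMove W A) (center b)
      (pt (p 0) (3 * c 1) (3 * c 2 + 2 * ε)) := by
    by_cases hx : p 0 = 3 * c 0
    · rwa [hx]
    · have u1 := up (3 * c 0) (3 * c 1) (by omega)
      have u2 := up (p 0) (3 * c 1) (by omega)
      refine s1.tail (u1.1.move u1.2 u2.2 ?_)
      simp only [adj_iff, pt_zero, pt_one, pt_two, true_and, and_true]; omega
  have s3 : Relation.ReflTransGen (CMove W A) (center b)
      (pt (p 0) (p 1) (3 * c 2 + 2 * ε)) := by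
    by_cases hy : p 1 = 3 * c 1
    · rwa [hy]
    · have u1 := up (p 0) (3 * c 1) (by omega)
      have u2 := up (p 0) (p 1) (by omega)
      refine s2.tail (u1.1.move u1.2 u2.2 ?_)
      simp only [adj_iff, pt_zero, pt_one, pt_two, true_and, and_true]; omega
  have u := up (p 0) (p 1) (by omega)
  have hcases : p 2 = 3 * c 2 + ε ∨ p 2 = 3 * c 2 ∨ p 2 = 3 * c 2 - ε := by omega
  have hlt : p 2 ≠ 3 * c 2 + ε → ε * p 2 < ε * (3 * c 2 + ε) := by
    intro hne
    rcases hε with rfl | rfl <;> omega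
  have hlt' : p 2 = 3 * c 2 - ε → ε * p 2 < ε * (3 * c 2) := by
    intro hne
    rcases hε with rfl | rfl <;> omega
  by_cases c1 : p 2 = 3 * c 2 + ε
  · refine s3.tail (u.1.move u.2 hpW ?_)
    simp only [adj_iff, pt_zero, pt_one, pt_two, true_and, and_true]; omega
  have v := down (3 * c 2 + ε) (by omega) (by omega) (hlt c1)
  have s4 : Relation.ReflTransGen (CMove W A) (center b) (pt (p 0) (p 1) (3 * c 2 + ε)) := by
    refine s3.tail (u.1.move u.2 v.2 ?_)
    simp only [adj_iff, pt_zero, pt_one, pt_two, true_and, and_true]; omega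
  by_cases c2 : p 2 = 3 * c 2
  · refine s4.tail (v.1.move v.2 hpW ?_)
    simp only [adj_iff, pt_zero, pt_one, pt_two, true_and, and_true]; omega
  have w := down (3 * c 2) (by omega) (by omega) (hlt' (by omega))
  have s5 : Relation.ReflTransGen (CMove W A) (center b) (pt (p 0) (p 1) (3 * c 2)) := by
    refine s4.tail (v.1.move v.2 w.2 ?_)
    simp only [adj_iff, pt_zero, pt_one, pt_two, true_and, and_true]; omega
  refine s5.tail (w.1.move w.2 hpW ?_)
  simp only [adj_iff, pt_zero, pt_one, pt_two, true_and, and_true]; omega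

end

/-! ### Contexts of the recursive construction -/

/-- The next position in direction `ε` of the last coordinate. -/
abbrev above (ε : ℤ) (c : Pos) : Pos := pt (c 0) (c 1) (c 2 + ε)

/-- A non-degenerate set `P` of cells inside a box `B` of cells, of which `b` is a corner. The tiles
of the cells in `B` belong to `W`. -/
structure World (P : Finset Pos) (W B : Set Pos) (b : Pos) : Prop where
  nonDegenerate : NonDegenerate P
  base : b ∈ B
  ray : ∀ j : ℤ, pt j (b 1) (b 2) ∉ P
  box : ∀ p ∈ P, ∀ q, Near p q → q ∈ B
  tile : ∀ c ∈ B, ∀ p, InCell p c → p ∈ W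

theorem World.base_notMem {P : Finset Pos} {W B : Set Pos} {b : Pos} (h : World P W B b) :
    b ∉ P := by
  have := h.ray (b 0)
  rwa [pt_eta] at this

theorem World.exists_adj {P : Finset Pos} {W B : Set Pos} {b : Pos} (h : World P W B b) {p q : Pos}
    (hp : p ∈ P) (hq : q ∈ P) (hn : Near p q) (hne : p ≠ q) (ha : ¬ grid.Adj p q) :
    ∃ t ∈ P, grid.Adj p t ∧ grid.Adj q t ∧ (t 2 = p 2 ∨ t 2 = q 2) := by
  obtain ⟨t, ht, h1, h2⟩ := h.nonDegenerate.exists_adj hp hq hn hne ha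
  refine ⟨t, ht, h1, h2, ?_⟩
  have h3 := hn.cases hne ha
  rw [adj_iff] at h1 h2
  rcases h3 with h3 | h3 | h3 <;> rcases h1 with h1 | h1 | h1 | h1 | h1 | h1 <;> omega

/-- A connected part `C` of `P` with levels (in direction `ε`) between `lo` and `hi` that is to be
built, starting from its cell `c₀` at the lowest level, while the cells in `Q₀` are blocked by the
tiles in `A₀`. -/
structure Ctx (P : Finset Pos) (B : Set Pos) (b : Pos) (ε lo hi : ℤ) (C : Finset Pos) (c₀ : Pos)
    (Q₀ : Set Pos) (A₀ : Finset Pos) : Prop where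
  sign : ε = 1 ∨ ε = -1
  sub : C ⊆ P
  conn : ∀ a ∈ C, ∀ c ∈ C, Relation.ReflTransGen (fun x y => grid.Adj x y ∧ y ∈ C) a c
  closed : ∀ k ∈ C, ∀ t ∈ P, grid.Adj k t → lo ≤ ε * t 2 → ε * t 2 ≤ hi → t ∈ C
  level : ∀ k ∈ C, lo ≤ ε * k 2 ∧ ε * k 2 ≤ hi
  root : c₀ ∈ C
  root_level : ε * c₀ 2 = lo
  subQ : Q₀ ⊆ P
  disj : ∀ k ∈ C, k ∉ Q₀
  not_adj : ∀ k ∈ C, ∀ q ∈ Q₀, ¬ grid.Adj k q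
  pinch : ∀ k ∈ C, ∀ q ∈ Q₀, Near k q → ε * q 2 = lo - 1 ∨ ε * q 2 = hi + 1
  unique : ∀ k ∈ C, ∀ k' ∈ C, ∀ q ∈ Q₀, ∀ q' ∈ Q₀, Near k q → Near k' q' → q 2 = q' 2 → q = q'
  -- The root is included because a bridge tile may lie in a free cell that has the root as one of
  -- its two blocked sides.
  filleted : Filleted A₀ (insert c₀ Q₀)
  -- Old tiles come close only to the root, and from below its bottom layer `3 * lo - 1`, so they do
  -- not hinder arrivals from above.
  far : ∀ a ∈ A₀, ∀ p c, InCell p c → c ∈ C → Within 2 p a → c = c₀ ∧ ε * a 2 < 3 * lo - 1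
  -- A single contact with the free region is what the potential argument needs.
  exposed : ∀ U ⊆ C, c₀ ∈ U → NearConn (U : Set Pos) →
    ∃ k ∈ U, ∃ e ∈ Free B b (Q₀ ∪ U), grid.Adj k e

namespace Ctx

variable {P : Finset Pos} {W B : Set Pos} {b : Pos} {ε lo hi : ℤ} {C : Finset Pos} {c₀ : Pos}
  {Q₀ : Set Pos} {A₀ : Finset Pos}

theorem subP (h : Ctx P B b ε lo hi C c₀ Q₀ A₀) {U : Finset Pos} (hU : U ⊆ C) :
    Q₀ ∪ (U : Set Pos) ⊆ P :=
  Set.union_subset h.subQ fun _ hx => h.sub (hU hx)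

theorem pinched (h : Ctx P B b ε lo hi C c₀ Q₀ A₀) (w : World P W B b) {U : Finset Pos}
    (hU : U ⊆ C) : ∃ lo' hi',
      Pinched (Free B b (Q₀ ∪ U)) U {q | q ∈ Q₀ ∧ ∃ k ∈ C, Near k q} (Q₀ ∪ U) lo' hi' := by
  have hbQ : b ∉ Q₀ ∪ (U : Set Pos) := fun hb => w.base_notMem (h.subP hU hb)
  have hle := h.level c₀ h.root
  have hs := h.sign
  -- For `ε = -1` the order of the levels is reversed.
  refine ⟨min (ε * lo) (ε * hi), max (ε * lo) (ε * hi), ?_⟩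
  refine ⟨min_le_max, fun e he => Free.notMem hbQ he, Set.subset_union_right, ?_, ?_, ?_, ?_, ?_, ?_⟩
  · exact fun v hv => .inl hv.1
  · intro e he e' hee hQ k hk hn
    exact Free.step he hee (w.box k (h.sub (hU hk)) _ hn) hQ
  · intro k hk q hq hn
    rcases hq with hq | hq
    · exact .inr ⟨hq, k, hU hk, hn⟩
    · exact .inl hq
  · intro k hk
    have := h.level k (hU hk)
    rcases hs with rfl | rfl <;> omega
  · rintro v ⟨hv, k, hk, hn⟩
    have := h.pinch k hk v hv hn
    rcases hs with rfl | rfl <;> omega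
  · rintro v ⟨hv, k, hk, hn⟩ v' ⟨hv', k', hk', hn'⟩ he
    exact h.unique k hk k' hk' v hv v' hv' hn hn' he

/-- The ray through the cell above a topmost cell of `U` runs at a level that `U` does not reach. -/
theorem free_above (h : Ctx P B b ε lo hi C c₀ Q₀ A₀) (w : World P W B b) {U : Finset Pos}
    (hU : U ⊆ C) (hc : c₀ ∈ U) (hconn : NearConn (U : Set Pos)) {s : Pos} (hs : s ∈ U)
    (hle : ∀ k ∈ U, ε * k 2 ≤ ε * s 2) : above ε s ∈ Free B b (Q₀ ∪ U) := by
  obtain ⟨lo', hi', hp⟩ := h.pinched w hU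
  obtain ⟨k, hk, e, he, hke⟩ := h.exposed U hU hc hconn
  have hε := h.sign
  have hadj : grid.Adj s (above ε s) := by simp [adj_iff]; omega
  have hray : ∀ j : ℤ, pt j (s 1) (s 2 + ε) ∉ (U : Set Pos) := fun j hj => by
    have := hle _ hj
    rcases hε with rfl | rfl <;> simp at this
  refine hp.mem_free (P.finite_toSet.subset (h.subP hU)) ?_ hconn hk he hke hs hadj ?_ ?_
  · exact fun j hj => w.ray j (h.sub (hU hj))
  · rintro (hq | hq)
    · exact h.not_adj s (hU hs) _ hq hadj
    · exact hray _ hq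
  · exact hray

/-- The ray of `t` may meet `U` at its own level, but the ray one level higher does not; hence the
detour through the neighbor in `mem_free'`. -/
theorem free_side (h : Ctx P B b ε lo hi C c₀ Q₀ A₀) (w : World P W B b) {U : Finset Pos}
    (hU : U ⊆ C) (hc : c₀ ∈ U) (hconn : NearConn (U : Set Pos)) {s t : Pos} (hs : s ∈ U)
    (ht : t ∈ C) (htU : t ∉ U) (hst : grid.Adj s t) (hle : ∀ k ∈ U, ε * k 2 ≤ ε * t 2) :
    t ∈ Free B b (Q₀ ∪ U) ∧ above ε t ∈ Free B b (Q₀ ∪ U) := by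
  obtain ⟨lo', hi', hp⟩ := h.pinched w hU
  obtain ⟨k, hk, e, he, hke⟩ := h.exposed U hU hc hconn
  have hε := h.sign
  have hadj : grid.Adj t (above ε t) := by simp [adj_iff]; omega
  have hray : ∀ j : ℤ, pt j (t 1) (t 2 + ε) ∉ (U : Set Pos) := fun j hj => by
    have := hle _ hj
    rcases hε with rfl | rfl <;> simp at this
  have hQ₀ : above ε t ∉ Q₀ := fun hq => h.not_adj t ht _ hq hadj
  have hQ : above ε t ∉ Q₀ ∪ (U : Set Pos) := by
    rintro (hq | hq)
    exacts [hQ₀ hq, hray _ hq]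
  have htfree : t ∈ Free B b (Q₀ ∪ U) := by
    refine hp.mem_free' (P.finite_toSet.subset (h.subP hU)) ?_ hconn hk he hke hs hst ?_ hadj ?_ ?_
    · exact fun j hj => w.ray j (h.sub (hU hj))
    · rintro (hq | hq)
      exacts [h.disj t ht hq, htU hq]
    · exact fun hv => hQ₀ hv.1
    · exact hray
  exact ⟨htfree, Free.step htfree hadj (w.box t (h.sub ht) _ (near_of_adj hadj)) hQ⟩

/-- A tile of a cell of `C` can be placed from above. -/
theorem addStep (h : Ctx P B b ε lo hi C c₀ Q₀ A₀) (w : World P W B b) {U A : Finset Pos}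
    (hU : U ⊆ C) (hA : Filleted A (Q₀ ∪ U)) {c p : Pos} (hcC : c ∈ C)
    (hpc : InCell p c) (hd : above ε c ∈ Free B b (Q₀ ∪ U))
    (hnew : ∀ a ∈ A, a ∉ A₀ → ε * a 2 ≤ ε * p 2)
    (htop : ∀ a ∈ A, a ∉ A₀ → a 2 = 3 * c 2 + ε → a 1 = 3 * c 1 → a 0 ≠ 3 * c 0 ∧ a 0 ≠ p 0)
    (hpA : p ∉ A)
    (hadj : ∃ r ∈ A, grid.Adj p r) : AddStep W b A p := by
  have hε := h.sign
  have hlev := h.level c hcC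
  refine hA.addStep w.tile w.base (fun hb => w.base_notMem (h.subP hU hb)) hε
    (w.box c (h.sub hcC) c (.refl c)) hd hpc ?_ ?_ hpA hadj
  -- In the column over `p`, old tiles are too low, and a new tile no higher than `p` could only be
  -- `p` itself.
  · intro z hz hz' hlt a ha hw
    have hyc : InCell (pt (p 0) (p 1) z) c := by
      unfold InCell at *; simp only [pt_zero, pt_one, pt_two]; omega
    by_cases haA : a ∈ A₀
    · have := h.far a haA _ c hyc hcC (by unfold Within at *; omega)
      unfold InCell at hpc
      simp only [Within, pt_zero, pt_one, pt_two] at hw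
      rcases hε with rfl | rfl <;> omega
    · have hle := hnew a ha haA
      refine hpA ?_
      rwa [show p = a from ?_]
      simp only [Within, pt_zero, pt_one, pt_two] at hw
      apply pos_ext <;> rcases hε with rfl | rfl <;> omega
  -- On the way across the top of `c`, only a tile directly underneath can interfere. It forces `p`
  -- into the top layer, and then it is `p` itself or is excluded by `htop`.
  · intro x y hxy a ha hw
    simp only [Within, pt_zero, pt_one, pt_two] at hw
    by_cases haA : a ∈ A₀
    · have := h.far a haA (pt x y (3 * c 2 + ε)) c ?_ hcC ?_
      · rcases hε with rfl | rfl <;> omega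
      · simp only [InCell, pt_zero, pt_one, pt_two] at *
        omega
      · simp only [Within, pt_zero, pt_one, pt_two] at *
        omega
    · have hle := hnew a ha haA
      have ht := htop a ha haA
      unfold InCell at hpc
      have h1 : a 0 = x ∧ a 1 = y ∧ a 2 = 3 * c 2 + ε ∧ a 2 = p 2 := by
        rcases hε with rfl | rfl <;> omega
      rcases hxy with ⟨hx, hy⟩ | ⟨hy, hx⟩
      · refine hpA ?_
        rwa [show p = a from pos_ext (by omega) (by omega) (by omega)]
      · have := ht h1.2.2.1 (by omega)
        omega

end Ctx

/-! ### Near-connected sets and components -/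

theorem NearConn.union {K L : Set Pos} (hK : NearConn K) (hL : NearConn L) {k l : Pos} (hk : k ∈ K)
    (hl : l ∈ L) (hkl : Near k l) : NearConn (K ∪ L) := by
  have monoK : ∀ a b, Relation.ReflTransGen (fun x y => y ∈ K ∧ Near x y) a b →
      Relation.ReflTransGen (fun x y => y ∈ K ∪ L ∧ Near x y) a b := fun a b h =>
    Relation.ReflTransGen.mono (fun x y hxy => ⟨.inl hxy.1, hxy.2⟩) _ _ h
  have monoL : ∀ a b, Relation.ReflTransGen (fun x y => y ∈ L ∧ Near x y) a b →
      Relation.ReflTransGen (fun x y => y ∈ K ∪ L ∧ Near x y) a b := fun a b h =>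
    Relation.ReflTransGen.mono (fun x y hxy => ⟨.inr hxy.1, hxy.2⟩) _ _ h
  rintro a (ha | ha) c (hc | hc)
  · exact monoK _ _ (hK a ha c hc)
  · exact ((monoK _ _ (hK a ha k hk)).tail ⟨.inr hl, hkl⟩).trans (monoL _ _ (hL l hl c hc))
  · exact ((monoL _ _ (hL a ha l hl)).tail ⟨.inl hk, hkl.symm⟩).trans (monoK _ _ (hK k hk c hc))
  · exact monoL _ _ (hL a ha c hc)

theorem nearConn_singleton (k : Pos) : NearConn {k} := by
  rintro a rfl c rfl
  exact .refl

theorem NearConn.insert {K : Finset Pos} (hK : NearConn (K : Set Pos)) {k l : Pos} (hk : k ∈ K)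
    (hkl : Near k l) : NearConn (insert l K : Finset Pos) := by
  have := hK.union (nearConn_singleton l) hk rfl hkl
  rwa [Finset.coe_insert, ← Set.union_singleton]

/-- The connected component of `k` in `D`. -/
noncomputable def component (D : Finset Pos) (k : Pos) : Finset Pos := by
  classical exact D.filter fun c => Relation.ReflTransGen (fun x y => grid.Adj x y ∧ y ∈ D) k c

section component

variable {D : Finset Pos} {k c d : Pos}

theorem mem_component : c ∈ component D k ↔
    c ∈ D ∧ Relation.ReflTransGen (fun x y => grid.Adj x y ∧ y ∈ D) k c := by
  simp [component]

theorem component_subset : component D k ⊆ D := fun _ h => (mem_component.1 h).1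

theorem component_step (h : c ∈ component D k) (hcd : grid.Adj c d) (hd : d ∈ D) :
    d ∈ component D k :=
  mem_component.2 ⟨hd, (mem_component.1 h).2.tail ⟨hcd, hd⟩⟩

theorem component_conn (hk : k ∈ D) (hc : c ∈ component D k) (hd : d ∈ component D k) :
    Relation.ReflTransGen (fun x y => grid.Adj x y ∧ y ∈ component D k) c d := by
  have key : ∀ c, Relation.ReflTransGen (fun x y => grid.Adj x y ∧ y ∈ D) k c →
      c ∈ component D k ∧
      Relation.ReflTransGen (fun x y => grid.Adj x y ∧ y ∈ component D k) k c ∧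
      Relation.ReflTransGen (fun x y => grid.Adj x y ∧ y ∈ component D k) c k := by
    intro c hc
    induction hc with
    | refl => exact ⟨mem_component.2 ⟨hk, .refl⟩, .refl, .refl⟩
    | @tail x y hx hxy ih =>
      have hy : y ∈ component D k := mem_component.2 ⟨hxy.2, hx.tail hxy⟩
      exact ⟨hy, ih.2.1.tail ⟨hxy.1, hy⟩, .head ⟨hxy.1.symm, ih.1⟩ ih.2.2⟩
  exact (key c (mem_component.1 hc).2).2.2.trans (key d (mem_component.1 hd).2).2.1

theorem component_nearConn (hk : k ∈ D) : NearConn (component D k : Set Pos) := fun _ ha _ hc =>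
  Relation.ReflTransGen.mono (fun _ _ h => ⟨h.2, near_of_adj h.1⟩) _ _ (component_conn hk ha hc)

theorem self_mem_component (hk : k ∈ D) : k ∈ component D k := mem_component.2 ⟨hk, .refl⟩

end component

/-! ### Feet and arms: the first tiles of a cell -/

/-- The middle of the side of the cell `s` opposite to the direction `ε`. -/
def foot (ε : ℤ) (s : Pos) : Pos := pt (3 * s 0) (3 * s 1) (3 * s 2 - ε)

/-- The tile of the cell `s` next to `foot ε s` in the direction of the cell `t`. -/
def arm (ε : ℤ) (s t : Pos) : Pos := pt (2 * s 0 + t 0) (2 * s 1 + t 1) (3 * s 2 - ε)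

section

variable {ε : ℤ} {s t : Pos}

theorem inCell_foot (hε : ε = 1 ∨ ε = -1) : InCell (foot ε s) s := by
  simp only [InCell, foot, pt_zero, pt_one, pt_two]; omega

theorem inCell_arm (hε : ε = 1 ∨ ε = -1) (hst : grid.Adj s t) : InCell (arm ε s t) s := by
  rw [adj_iff] at hst
  simp only [InCell, arm, pt_zero, pt_one, pt_two]; omega

theorem level_foot (hε : ε = 1 ∨ ε = -1) : ε * foot ε s 2 = 3 * (ε * s 2) - 1 := by
  simp only [foot, pt_two]
  rcases hε with rfl | rfl <;> omega

theorem level_arm (hε : ε = 1 ∨ ε = -1) : ε * arm ε s t 2 = 3 * (ε * s 2) - 1 :=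
  level_foot hε

theorem adj_arm_foot (hst : grid.Adj s t) (h : s 2 = t 2) :
    grid.Adj (arm ε s t) (foot ε s) := by
  rw [adj_iff] at *
  simp only [foot, arm, pt_zero, pt_one, pt_two, true_and, and_true]; omega

theorem adj_arm_arm (hst : grid.Adj s t) (h : s 2 = t 2) :
    grid.Adj (arm ε s t) (arm ε t s) := by
  rw [adj_iff] at *
  simp only [arm, pt_zero, pt_one, pt_two, true_and, and_true]; omega

/-- Tiles of cells that differ in all three coordinates are at distance at least 3, and at least 4
if some coordinate of the cells differs by 2. -/
theorem Within.near {p q c d : Pos} (h : Within 2 p q) (hp : InCell p c) (hq : InCell q d) :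
    Near c d := by
  unfold Within InCell Near at *
  omega

/-- From the foot, leaving the column of cells sideways already takes two steps, so none is left for
going down. -/
theorem eq_of_within_foot (hε : ε = 1 ∨ ε = -1) {p c : Pos} (hp : InCell p c)
    (h : Within 2 p (foot ε s)) (hl : ε * c 2 < ε * s 2) : c = above (-ε) s := by
  simp only [Within, InCell, foot, pt_zero, pt_one, pt_two] at *
  apply pos_ext <;> simp only [pt_zero, pt_one, pt_two] <;> rcases hε with rfl | rfl <;> omega

/-- An arm borders on `t`, so one step sideways and one down reach the cell below `t`; other lower
cells except the one below `s` are too far. -/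
theorem eq_of_within_arm (hε : ε = 1 ∨ ε = -1) (hst : grid.Adj s t) (h2 : s 2 = t 2) {p c : Pos}
    (hp : InCell p c) (h : Within 2 p (arm ε s t)) (hl : ε * c 2 < ε * s 2) :
    c = above (-ε) s ∨ c = above (-ε) t := by
  rw [adj_iff] at hst
  have key : ∀ d : Pos, c 0 = d 0 ∧ c 1 = d 1 → c 2 = s 2 - ε → d 2 = s 2 → c = above (-ε) d := by
    intro d h1 h3 h4
    apply pos_ext <;> simp only [pt_zero, pt_one, pt_two] <;> omega
  simp only [Within, InCell, arm, pt_zero, pt_one, pt_two] at *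
  have hc2 : c 2 = s 2 - ε := by rcases hε with rfl | rfl <;> omega
  have : (c 0 = s 0 ∧ c 1 = s 1) ∨ (c 0 = t 0 ∧ c 1 = t 1) := by
    rcases hst with hst | hst | hst | hst | hst | hst <;> rcases hε with rfl | rfl <;> omega
  exact this.imp (key s · hc2 rfl) (key t · hc2 h2.symm)

end

/-- One more tile, unless it is already there. -/
theorem Builds.insert {W : Set Pos} {b : Pos} {A : Finset Pos} {p : Pos}
    (h : p ∉ A → AddStep W b A p) : Builds W b A (insert p A) := by
  by_cases hp : p ∈ A
  · rw [Finset.insert_eq_of_mem hp]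
    exact .refl
  · exact .single ⟨p, h hp, rfl⟩

theorem Filleted.insert {A : Finset Pos} {Q : Set Pos} (h : Filleted A Q) {p c : Pos}
    (hc : c ∈ Q) (hp : InCell p c) : Filleted (insert p A) Q := by
  intro a ha d hd
  rcases Finset.mem_insert.1 ha with rfl | ha
  · exact .inl (hd.unique hp ▸ hc)
  · exact h a ha d hd

theorem Filleted.union {A A' : Finset Pos} {Q : Set Pos} (h : Filleted A Q)
    (h' : ∀ a ∈ A', ∃ c ∈ Q, InCell a c) : Filleted (A ∪ A') Q := by
  intro a ha d hd
  rcases Finset.mem_union.1 ha with ha | ha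
  · exact h a ha d hd
  · obtain ⟨c, hc, hac⟩ := h' a ha
    exact .inl (hd.unique hac ▸ hc)

/-- The tile `arm ε t s` may be in a cell that is not blocked, if the cells `s` and
`above (-ε) t` are blocked. -/
theorem Filleted.insert_arm {A : Finset Pos} {Q : Set Pos} (h : Filleted A Q) {ε : ℤ}
    (hε : ε = 1 ∨ ε = -1) {s t : Pos} (hst : grid.Adj s t) (h2 : s 2 = t 2) (hs : s ∈ Q)
    (ht : above (-ε) t ∈ Q) : Filleted (Insert.insert (arm ε t s) A) Q := by
  intro a ha d hd
  rcases Finset.mem_insert.1 ha with rfl | ha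
  · obtain rfl := hd.unique (inCell_arm hε hst.symm)
    rw [adj_iff] at hst
    refine .inr ⟨-ε, s 0 - d 0, s 1 - d 1, by omega, by omega, ?_, ?_, ht⟩
    · apply pos_ext <;> simp only [arm, pt_zero, pt_one, pt_two] <;> ring
    · rwa [show pt (d 0 + (s 0 - d 0)) (d 1 + (s 1 - d 1)) (d 2) = s from ?_]
      apply pos_ext <;> simp only [pt_zero, pt_one, pt_two] <;> omega
  · exact h a ha d hd

namespace Ctx

variable {P : Finset Pos} {W B : Set Pos} {b : Pos} {ε lo hi : ℤ} {C : Finset Pos} {c₀ : Pos}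
  {Q₀ : Set Pos} {A₀ : Finset Pos}

/-- A tile of the bottom layer of a cell at level `J` can be placed from above. -/
theorem place (h : Ctx P B b ε lo hi C c₀ Q₀ A₀) (w : World P W B b) {U A : Finset Pos} {J : ℤ}
    (hU : U ⊆ C) (hA : Filleted A (Q₀ ∪ U))
    (hnew : ∀ a ∈ A, a ∉ A₀ → ε * a 2 ≤ 3 * J - 1) {c p : Pos} (hcC : c ∈ C) (hcJ : ε * c 2 = J)
    (hpc : InCell p c) (hpJ : ε * p 2 = 3 * J - 1) (hd : above ε c ∈ Free B b (Q₀ ∪ U))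
    (hadj : ∃ r ∈ A, grid.Adj p r) : Builds W b A (insert p A) := by
  refine Builds.insert fun hp => h.addStep w hU hA hcC hpc hd ?_ ?_ hp hadj
  · intro a ha ha'
    rw [hpJ]
    exact hnew a ha ha'
  · intro a ha ha' h2
    exfalso
    have := hnew a ha ha'
    have hε := h.sign
    rcases hε with rfl | rfl <;> omega

/-- A part of `C` that is closed under adjacency below the level `J` is separated from the rest of
`C` below the level `J`. -/
theorem not_near (h : Ctx P B b ε lo hi C c₀ Q₀ A₀) (w : World P W B b) {U : Finset Pos} {J : ℤ}
    (hJ : J ≤ hi + 1)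
    (hU : ∀ k ∈ U, ε * k 2 < J → ∀ t ∈ C, grid.Adj k t → ε * t 2 < J → t ∈ U) {k k' : Pos}
    (hk : k ∈ U) (hkC : k ∈ C) (hk' : k' ∈ C) (hk'U : k' ∉ U) (hl : ε * k 2 < J)
    (hl' : ε * k' 2 < J) : ¬ Near k k' := by
  intro hn
  have hne : k ≠ k' := fun he => hk'U (he ▸ hk)
  by_cases ha : grid.Adj k k'
  · exact hk'U (hU k hk hl k' hk' ha hl')
  obtain ⟨t, ht, h1, h2, h3⟩ := w.exists_adj (h.sub hkC) (h.sub hk') hn hne ha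
  have l := h.level k hkC
  have l' := h.level k' hk'
  have hlt : lo ≤ ε * t 2 ∧ ε * t 2 < J := by rcases h3 with h3 | h3 <;> rw [h3] <;> omega
  have htC : t ∈ C := h.closed k hkC t ht h1 hlt.1 (by omega)
  exact hk'U (hU t (hU k hk hl t htC h1 hlt.2) hlt.2 k' hk' h2.symm hl')

end Ctx

/-! ### Invariants during the construction of a level -/

/-- The state of the construction of `C` when the cells of `U` are blocked by the tiles in `A`,
the layers of tiles below the level `J` of cells are finished in `U`, and only the lowest layer of
tiles at the level `J` of cells has been begun. -/
structure Stage (ε : ℤ) (C : Finset Pos) (c₀ : Pos) (Q₀ : Set Pos) (A₀ : Finset Pos) (J : ℤ)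
    (U A : Finset Pos) : Prop where
  sub : U ⊆ C
  root : c₀ ∈ U
  conn : NearConn (U : Set Pos)
  le : ∀ k ∈ U, ε * k 2 ≤ J
  subA : A₀ ⊆ A
  new : ∀ a ∈ A, a ∉ A₀ → ε * a 2 ≤ 3 * J - 1 ∧ ∃ c ∈ C, InCell a c
  filleted : Filleted A (Q₀ ∪ U)
  full : ∀ k ∈ U, ε * k 2 < J → ∀ p, InCell p k → p ∈ A
  closed : ∀ k ∈ U, ε * k 2 < J → ∀ t ∈ C, grid.Adj k t → ε * t 2 < J → t ∈ U
  -- This keeps the space around pending cells empty, as the recursive contexts demand.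
  far : ∀ a ∈ A, ∀ p c, InCell p c → c ∈ C → c ∉ U → ε * c 2 < J → ¬ Within 2 p a

/-- The cells of `U` at the level `J` contain a tile at their foot, and, apart from the cells in
`X`, they are separated from the remaining cells below the level `J`. -/
structure Settled (ε : ℤ) (C : Finset Pos) (c₀ : Pos) (Q₀ : Set Pos) (A₀ : Finset Pos) (J : ℤ)
    (X : Set Pos) (U A : Finset Pos) : Prop extends Stage ε C c₀ Q₀ A₀ J U A where
  center : ∀ k ∈ U, ε * k 2 = J → foot ε k ∈ A
  sep : ∀ k ∈ U, k ∉ X → ε * k 2 = J → ∀ c ∈ C, c ∉ U → ε * c 2 < J → ¬ Near k c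

namespace Stage

variable {P : Finset Pos} {W B : Set Pos} {b : Pos} {ε lo hi J : ℤ} {C : Finset Pos} {c₀ : Pos}
  {Q₀ : Set Pos} {A₀ U A : Finset Pos}

theorem insert_cell (st : Stage ε C c₀ Q₀ A₀ J U A) {k s : Pos} (hk : k ∈ U) (hs : s ∈ C)
    (hsJ : ε * s 2 = J) (hks : Near k s) : Stage ε C c₀ Q₀ A₀ J (insert s U) A where
  sub := Finset.insert_subset hs st.sub
  root := Finset.mem_insert_of_mem st.root
  conn := st.conn.insert hk hks
  le := by
    intro x hx
    rcases Finset.mem_insert.1 hx with rfl | hx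
    · exact hsJ.le
    · exact st.le x hx
  subA := st.subA
  new := st.new
  filleted := st.filleted.mono (Set.union_subset_union_right _ (by simp))
  full := by
    intro x hx hl
    rcases Finset.mem_insert.1 hx with rfl | hx
    · omega
    · exact st.full x hx hl
  closed := by
    intro x hx hl t ht hxt hlt
    rcases Finset.mem_insert.1 hx with rfl | hx
    · omega
    · exact Finset.mem_insert_of_mem (st.closed x hx hl t ht hxt hlt)
  far := fun a ha p c hp hc hcU hl =>
    st.far a ha p c hp hc (fun h => hcU (Finset.mem_insert_of_mem h)) hl

theorem insert_tile (st : Stage ε C c₀ Q₀ A₀ J U A) {p c : Pos} (hc : c ∈ U) (hpc : InCell p c)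
    (hp : ε * p 2 ≤ 3 * J - 1)
    (hfar : ∀ q d, InCell q d → d ∈ C → d ∉ U → ε * d 2 < J → ¬ Within 2 q p) :
    Stage ε C c₀ Q₀ A₀ J U (insert p A) :=
  { st with
    subA := st.subA.trans (Finset.subset_insert _ _)
    new := by
      intro a ha ha'
      rcases Finset.mem_insert.1 ha with rfl | ha
      · exact ⟨hp, c, st.sub hc, hpc⟩
      · exact st.new a ha ha'
    filleted := st.filleted.insert (.inr hc) hpc
    full := fun k hk hl p hp => Finset.mem_insert_of_mem (st.full k hk hl p hp)
    far := by
      intro a ha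
      rcases Finset.mem_insert.1 ha with rfl | ha
      · exact hfar
      · exact st.far a ha }

/-- Cells at the level `J` are topmost in `U`, so `free_above` gives access to them. -/
theorem place (st : Stage ε C c₀ Q₀ A₀ J U A) (h : Ctx P B b ε lo hi C c₀ Q₀ A₀)
    (w : World P W B b) {p c : Pos} (hc : c ∈ U) (hcJ : ε * c 2 = J) (hpc : InCell p c)
    (hpJ : ε * p 2 = 3 * J - 1) (hadj : ∃ r ∈ A, grid.Adj p r) : Builds W b A (insert p A) :=
  h.place w st.sub st.filleted (fun a ha ha' => (st.new a ha ha').1) (st.sub hc) hcJ hpc hpJ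
    (h.free_above w st.sub st.root st.conn hc fun k hk => by rw [hcJ]; exact st.le k hk) hadj

end Stage

theorem above_neg_above {ε : ℤ} (s : Pos) : above ε (above (-ε) s) = s := by
  apply pos_ext <;> simp

theorem adj_above {ε : ℤ} (hε : ε = 1 ∨ ε = -1) (s : Pos) : grid.Adj s (above ε s) := by
  simp only [adj_iff, pt_zero, pt_one, pt_two, true_and, and_true]; omega

theorem level_above {ε : ℤ} (hε : ε = 1 ∨ ε = -1) (s : Pos) :
    ε * above (-ε) s 2 = ε * s 2 - 1 := by
  change ε * (s 2 + -ε) = _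
  rcases hε with rfl | rfl <;> ring

namespace Settled

variable {P : Finset Pos} {W B : Set Pos} {b : Pos} {ε lo hi J : ℤ} {C : Finset Pos} {c₀ : Pos}
  {Q₀ : Set Pos} {A₀ U A : Finset Pos}

/-- Start of a new cell at the level `J`. -/
theorem exists_insert (st : Settled ε C c₀ Q₀ A₀ J ∅ U A) (h : Ctx P B b ε lo hi C c₀ Q₀ A₀)
    (w : World P W B b) {s k : Pos} (hs : s ∈ C) (hsU : s ∉ U) (hsJ : ε * s 2 = J) (hk : k ∈ U)
    (hks : grid.Adj k s) : ∃ A', Builds W b A A' ∧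
      Settled ε C c₀ Q₀ A₀ J {s} (insert s U) A' ∧ (above (-ε) s ∈ C → above (-ε) s ∈ U) := by
  have hε := h.sign
  have st₁ := st.toStage.insert_cell hk hs hsJ (near_of_adj hks)
  have hsU' : s ∈ insert s U := Finset.mem_insert_self _ _
  have sep : ∀ k ∈ insert s U, k ∉ ({s} : Set Pos) → ε * k 2 = J → ∀ c ∈ C, c ∉ insert s U →
      ε * c 2 < J → ¬ Near k c := by
    intro k hk hks hkJ c hc hcU hl
    have hk' : k ∈ U := (Finset.mem_insert.1 hk).resolve_left hks
    exact st.sep k hk' (by simp) hkJ c hc (fun h => hcU (Finset.mem_insert_of_mem h)) hl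
  have hlev := level_above hε s
  have hkl := st.le k hk
  -- Either `k` is the finished cell below `s` and carries the new foot, or two arms lead from the
  -- foot of `k` to that of `s`.
  have hcase : k = above (-ε) s ∨ s 2 = k 2 := by
    rw [adj_iff] at hks
    by_cases h2 : s 2 = k 2
    · exact .inr h2
    · left
      apply pos_ext <;> simp only [pt_zero, pt_one, pt_two] <;> rcases hε with rfl | rfl <;> omega
  rcases hcase with rfl | h2
  · have hfar : ∀ q d, InCell q d → d ∈ C → d ∉ insert s U → ε * d 2 < J →
        ¬ Within 2 q (foot ε s) := by
      intro q d hq hd hdU hl hw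
      rw [eq_of_within_foot hε hq hw (by omega)] at hdU
      exact hdU (Finset.mem_insert_of_mem hk)
    refine ⟨insert (foot ε s) A, ?_, ⟨?_, ?_, sep⟩, fun _ => hk⟩
    · refine st₁.place h w hsU' hsJ (inCell_foot hε) (by rw [level_foot hε, hsJ]) ?_
      refine ⟨pt (3 * s 0) (3 * s 1) (3 * s 2 - 2 * ε), ?_, ?_⟩
      · refine st.full _ hk (by omega) _ ?_
        simp only [InCell, pt_zero, pt_one, pt_two]; omega
      · simp only [adj_iff, foot, pt_zero, pt_one, pt_two, true_and, and_true]; omega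
    · exact st₁.insert_tile hsU' (inCell_foot hε) (by rw [level_foot hε, hsJ]) hfar
    · intro x hx hxJ
      rcases Finset.mem_insert.1 hx with rfl | hx
      · exact Finset.mem_insert_self _ _
      · exact Finset.mem_insert_of_mem (st.center x hx hxJ)
  · have hkJ : ε * k 2 = J := by rw [← h2, hsJ]
    have hkU' : k ∈ insert s U := Finset.mem_insert_of_mem hk
    have hlevk := level_above hε k
    -- The cell below `s` shares an edge with `k`, so it cannot be pending by the separation of `k`.
    have hks' : above (-ε) s ∈ C → above (-ε) s ∈ U := by
      intro hC
      by_contra hU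
      refine st.sep k hk (by simp) hkJ _ hC hU (by omega) ?_
      rw [adj_iff] at hks
      simp only [Near, pt_zero, pt_one, pt_two]
      omega
    have hkk' : above (-ε) k ∈ C → above (-ε) k ∈ U := by
      intro hC
      by_contra hU
      refine st.sep k hk (by simp) hkJ _ hC hU (by omega) (near_of_adj (adj_above ?_ _))
      omega
    have mem : ∀ x ∈ U, x ∈ insert s U := fun x hx => Finset.mem_insert_of_mem hx
    have far₁ : ∀ q d, InCell q d → d ∈ C → d ∉ insert s U → ε * d 2 < J →
        ¬ Within 2 q (arm ε k s) := by
      intro q d hq hd hdU hl hw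
      rcases eq_of_within_arm hε hks h2.symm hq hw (by omega) with rfl | rfl
      exacts [hdU (mem _ (hkk' hd)), hdU (mem _ (hks' hd))]
    have far₂ : ∀ q d, InCell q d → d ∈ C → d ∉ insert s U → ε * d 2 < J →
        ¬ Within 2 q (arm ε s k) := by
      intro q d hq hd hdU hl hw
      rcases eq_of_within_arm hε hks.symm h2 hq hw (by omega) with rfl | rfl
      exacts [hdU (mem _ (hks' hd)), hdU (mem _ (hkk' hd))]
    have far₃ : ∀ q d, InCell q d → d ∈ C → d ∉ insert s U → ε * d 2 < J →
        ¬ Within 2 q (foot ε s) := by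
      intro q d hq hd hdU hl hw
      obtain rfl := eq_of_within_foot hε hq hw (by omega)
      exact hdU (mem _ (hks' hd))
    have st₂ := st₁.insert_tile hkU' (inCell_arm hε hks) (by rw [level_arm hε, hkJ]) far₁
    have st₃ := st₂.insert_tile hsU' (inCell_arm hε hks.symm) (by rw [level_arm hε, hsJ]) far₂
    have st₄ := st₃.insert_tile hsU' (inCell_foot hε) (by rw [level_foot hε, hsJ]) far₃
    refine ⟨_, ?_, ⟨st₄, ?_, sep⟩, hks'⟩
    · refine ((st₁.place h w hkU' hkJ (inCell_arm hε hks) (by rw [level_arm hε, hkJ])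
        ⟨_, st.center k hk hkJ, adj_arm_foot hks h2.symm⟩).trans
        (st₂.place h w hsU' hsJ (inCell_arm hε hks.symm) (by rw [level_arm hε, hsJ])
        ⟨_, Finset.mem_insert_self _ _, (adj_arm_arm hks.symm h2)⟩)).trans
        (st₃.place h w hsU' hsJ (inCell_foot hε) (by rw [level_foot hε, hsJ])
        ⟨_, Finset.mem_insert_self _ _, (adj_arm_foot hks.symm h2).symm⟩)
    · intro x hx hxJ
      rcases Finset.mem_insert.1 hx with rfl | hx
      · exact Finset.mem_insert_self _ _
      · simp only [Finset.mem_insert]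
        exact .inr (.inr (.inr (st.center x hx hxJ)))

end Settled

/-- The set `C` of cells can be built in all contexts, once the foot of its root is there. -/
def Solvable (P : Finset Pos) (W B : Set Pos) (b : Pos) (C : Finset Pos) : Prop :=
  ∀ ε lo hi c₀ Q₀ A₀ R, Ctx P B b ε lo hi C c₀ Q₀ A₀ →
    (∀ r ∈ R, InCell r c₀ ∧ ε * r 2 = 3 * lo - 1) → foot ε c₀ ∈ R →
    Builds W b (A₀ ∪ R) (A₀ ∪ tiles C)

/-- In a context, the foot of the root can be placed next to a tile above the middle of an upper
edge of the root. -/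
theorem Solvable.builds {P : Finset Pos} {W B : Set Pos} {b : Pos} {ε lo hi : ℤ} {C : Finset Pos}
    {c₀ : Pos} {Q₀ : Set Pos} {A₀ : Finset Pos} (hC : Solvable P W B b C) (w : World P W B b)
    (h : Ctx P B b ε lo hi C c₀ Q₀ A₀) {t : Pos} (hadj : grid.Adj c₀ t) (h2 : c₀ 2 = t 2)
    (hA : ∃ a ∈ A₀, grid.Adj (arm ε c₀ t) a) : Builds W b A₀ (A₀ ∪ tiles C) := by
  have hε := h.sign
  have hl := h.root_level
  have hf : Filleted A₀ (Q₀ ∪ ({c₀} : Finset Pos)) := by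
    rw [Finset.coe_singleton, Set.union_singleton]
    exact h.filleted
  have hfree : above ε c₀ ∈ Free B b (Q₀ ∪ ({c₀} : Finset Pos)) := by
    refine h.free_above w (Finset.singleton_subset_iff.2 h.root) (Finset.mem_singleton_self _) ?_
      (Finset.mem_singleton_self _) ?_
    · simpa using nearConn_singleton c₀
    · simp
  have s₁ := h.place w (J := lo) (Finset.singleton_subset_iff.2 h.root)
    hf (fun a ha ha' => absurd ha ha') h.root hl
    (inCell_arm hε hadj) (by rw [level_arm hε, hl]) hfree hA
  have s₂ := h.place w (J := lo) (Finset.singleton_subset_iff.2 h.root)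
    (hf.insert (by simp) (inCell_arm hε hadj)) (by
      intro a ha ha'
      rw [(Finset.mem_insert.1 ha).resolve_right ha', level_arm hε, hl]) h.root hl
    (inCell_foot hε) (by rw [level_foot hε, hl]) hfree
    ⟨_, Finset.mem_insert_self _ _, (adj_arm_foot hadj h2).symm⟩
  have s₃ := hC ε lo hi c₀ Q₀ A₀ {foot ε c₀, arm ε c₀ t} h (by
    intro r hr
    rcases Finset.mem_insert.1 hr with rfl | hr
    · exact ⟨inCell_foot hε, by rw [level_foot hε, hl]⟩
    · rw [Finset.mem_singleton.1 hr]
      exact ⟨inCell_arm hε hadj, by rw [level_arm hε, hl]⟩) (Finset.mem_insert_self _ _)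
  refine (s₁.trans s₂).trans ?_
  rwa [Finset.union_insert, Finset.union_comm A₀ {_}, ← Finset.insert_eq] at s₃

/-! ### Components hanging below the current level -/

namespace Settled

variable {P : Finset Pos} {W B : Set Pos} {b : Pos} {ε lo hi J : ℤ} {C : Finset Pos} {c₀ : Pos}
  {Q₀ : Set Pos} {A₀ U A : Finset Pos}

/-- A pending cell near the last cell `s` hangs below a neighbor `t` of `s`. -/
theorem exists_hanging {s k : Pos} (st : Settled ε C c₀ Q₀ A₀ J {s} U A)
    (h : Ctx P B b ε lo hi C c₀ Q₀ A₀) (w : World P W B b) (hs : s ∈ U) (hsJ : ε * s 2 = J)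
    (hsb : above (-ε) s ∈ C → above (-ε) s ∈ U) (hk : k ∈ C) (hkU : k ∉ U) (hkJ : ε * k 2 < J)
    (hsk : Near s k) : ∃ t ∈ C, t ∉ U ∧ grid.Adj s t ∧ s 2 = t 2 ∧ k = above (-ε) t := by
  have hε := h.sign
  have hsC := st.sub hs
  have ls := h.level s hsC
  have lk := h.level k hk
  have hlev := level_above hε s
  -- Otherwise the cell below `s` is in `C`, hence blocked, and closure below `J` would block `k` as
  -- well.
  have hbelow : above (-ε) s ∈ P → ¬ grid.Adj k (above (-ε) s) := by
    intro hP ha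
    have hkl : ε * k 2 = J - 1 := by
      obtain ⟨-, -, n, -⟩ := hsk
      rcases hε with rfl | rfl <;> omega
    have hC := h.closed k hk _ hP ha (by omega) (by omega)
    exact hkU (st.closed _ (hsb hC) (by omega) k hk ha.symm hkJ)
  have hadj : ¬ grid.Adj s k := by
    intro ha
    have : k = above (-ε) s := by
      rw [adj_iff] at ha
      apply pos_ext <;> simp only [pt_zero, pt_one, pt_two] <;> rcases hε with rfl | rfl <;> omega
    subst this
    exact hkU (hsb hk)
  obtain ⟨t, ht, h1, h2, h3⟩ := w.exists_adj (h.sub hsC) (h.sub hk) hsk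
    (fun he => hkU (he ▸ hs)) hadj
  have htC : t ∈ C := h.closed s hsC t ht h1 (by rcases h3 with h3 | h3 <;> rw [h3] <;> omega)
    (by rcases h3 with h3 | h3 <;> rw [h3] <;> omega)
  have hts : t ≠ above (-ε) s := by
    rintro rfl
    exact hbelow ht h2
  have key : s 2 = t 2 ∧ k = above (-ε) t := by
    have hne : ¬ (t 0 = s 0 ∧ t 1 = s 1 ∧ t 2 = s 2 - ε) := by
      rintro ⟨e0, e1, e2⟩
      refine hts (pos_ext ?_ ?_ ?_) <;> simp only [pt_zero, pt_one, pt_two] <;> omega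
    have : s 2 = t 2 ∧ k 0 = t 0 ∧ k 1 = t 1 ∧ k 2 = t 2 - ε := by
      rw [adj_iff] at h1 h2
      rcases h1 with h1 | h1 | h1 | h1 | h1 | h1 <;> rcases hε with rfl | rfl <;> omega
    refine ⟨this.1, pos_ext ?_ ?_ ?_⟩ <;> simp only [pt_zero, pt_one, pt_two] <;> omega
  refine ⟨t, htC, fun htU => ?_, h1, key.1, key.2⟩
  -- If `t` were blocked, it would be a cell other than `s` that is near a pending one.
  refine st.sep t htU ?_ (by rw [← key.1, hsJ]) k hk hkU hkJ (near_of_adj h2.symm)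
  rintro rfl
  exact grid.loopless.irrefl _ h1

/-- The context in which the component of a pending cell is built. -/
theorem child_ctx {s t : Pos} (st : Settled ε C c₀ Q₀ A₀ J {s} U A)
    (h : Ctx P B b ε lo hi C c₀ Q₀ A₀) (w : World P W B b) (hs : s ∈ U) (hsJ : ε * s 2 = J)
    (hsb : above (-ε) s ∈ C → above (-ε) s ∈ U) (ht : t ∈ C) (htU : t ∉ U) (hst : grid.Adj s t)
    (h2 : s 2 = t 2) {k : Pos} (hkt : k = above (-ε) t) (hk : k ∈ C) (hkU : k ∉ U) :
    Ctx P B b (-ε) (-(J - 1)) (-lo) (component (C.filter fun c => ε * c 2 < J) k) k (Q₀ ∪ U)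
      (insert (arm ε t s) (insert (arm ε s t) A)) := by
  have hε := h.sign
  have hsC := st.sub hs
  have ls := h.level s hsC
  set D := C.filter fun c => ε * c 2 < J with hD
  have memD : ∀ {c}, c ∈ D ↔ c ∈ C ∧ ε * c 2 < J := by simp [hD]
  have hkl : ε * k 2 = J - 1 := by rw [hkt, level_above hε, ← h2, hsJ]
  have hkD : k ∈ D := memD.2 ⟨hk, by omega⟩
  have hC : ∀ {c}, c ∈ component D k → c ∈ C ∧ ε * c 2 < J := fun hc =>
    memD.1 (component_subset hc)
  have hsk : Near s k := by
    rw [hkt]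
    rw [adj_iff] at hst
    simp only [Near, pt_zero, pt_one, pt_two]
    omega
  have hU : ∀ {c}, c ∈ component D k → c ∉ U := by
    intro c hc
    have hc' := (mem_component.1 hc).2
    clear hc
    induction hc' with
    | refl => exact hkU
    | @tail x y hx hxy ih =>
      intro hy
      refine ih (st.closed y hy (memD.1 hxy.2).2 x ?_ hxy.1.symm ?_)
      all_goals
      rcases Relation.ReflTransGen.cases_tail hx with rfl | ⟨_, _, h⟩
      · first | exact hk | omega
      · first | exact (memD.1 h.2).1 | exact (memD.1 h.2).2
  -- Below the level `J` the component is separated from `U`; at the level `J` only `s` can be near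
  -- it. So `s` is the only pinch point on this side.
  have hnear : ∀ c ∈ component D k, ∀ q ∈ U, Near c q → ε * q 2 = J := by
    intro c hc q hq hn
    by_contra hne
    have hq' : ε * q 2 < J := lt_of_le_of_ne (st.le q hq) hne
    exact h.not_near w (by omega) st.closed hq (st.sub hq) (hC hc).1 (hU hc) hq' (hC hc).2 hn.symm
  have hnear' : ∀ c ∈ component D k, ∀ q ∈ U, Near c q → q = s := by
    intro c hc q hq hn
    by_contra hne
    exact st.sep q hq hne (hnear c hc q hq hn) c (hC hc).1 (hU hc) (hC hc).2 hn.symm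
  have hnear₀ : ∀ c ∈ component D k, ∀ q ∈ Q₀, Near c q → ε * q 2 = lo - 1 := by
    intro c hc q hq hn
    refine (h.pinch c (hC hc).1 q hq hn).resolve_right fun hh => ?_
    have := (hC hc).2
    obtain ⟨-, -, n, -⟩ := hn
    rcases hε with rfl | rfl <;> omega
  have hbel : ∀ c ∈ component D k, c ≠ above (-ε) s := by
    rintro c hc rfl
    exact hU hc (hsb (hC hc).1)
  constructor
  case sign => omega
  case sub => exact fun c hc => h.sub (hC hc).1
  case conn => exact fun a ha c hc => component_conn hkD ha hc
  case closed =>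
    intro c hc x hx hcx hl hl'
    have hxC := h.closed c (hC hc).1 x hx hcx (by linarith) (by linarith)
    exact component_step hc hcx (memD.2 ⟨hxC, by linarith⟩)
  case level =>
    intro c hc
    have := h.level c (hC hc).1
    have := (hC hc).2
    rw [neg_mul]
    omega
  case root => exact self_mem_component hkD
  case root_level => rw [neg_mul, hkl]
  case subQ => exact h.subP st.sub
  case disj =>
    rintro c hc (hq | hq)
    exacts [h.disj c (hC hc).1 hq, hU hc hq]
  case not_adj =>
    rintro c hc q (hq | hq) ha
    · exact h.not_adj c (hC hc).1 q hq ha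
    -- Adjacency to `s` from a lower level would make `c` the cell below `s`, which is not pending.
    · obtain rfl := hnear' c hc q hq (near_of_adj ha)
      refine hbel c hc ?_
      have := (hC hc).2
      rw [adj_iff] at ha
      apply pos_ext <;> simp only [pt_zero, pt_one, pt_two] <;> rcases hε with rfl | rfl <;> omega
  case pinch =>
    rintro c hc q (hq | hq) hn
    · have := hnear₀ c hc q hq hn
      rw [neg_mul]
      omega
    · have := hnear c hc q hq hn
      rw [neg_mul]
      omega
  case unique =>
    rintro c hc c' hc' q (hq | hq) q' (hq' | hq') hn hn' he
    · exact h.unique c (hC hc).1 c' (hC hc').1 q hq q' hq' hn hn' he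
    · have h1 := hnear₀ c hc q hq hn
      have h3 := hnear c' hc' q' hq' hn'
      rw [he] at h1
      omega
    · have h1 := hnear c hc q hq hn
      have h3 := hnear₀ c' hc' q' hq' hn'
      rw [he] at h1
      omega
    · rw [hnear' c hc q hq hn, hnear' c' hc' q' hq' hn']
  case filleted =>
    have hf : Filleted A (insert k (Q₀ ∪ U)) := st.filleted.mono (Set.subset_insert _ _)
    refine (hf.insert (.inr (.inr hs)) (inCell_arm hε hst)).insert_arm hε hst h2
      (.inr (.inr hs)) (.inl hkt.symm)
  case far =>
    intro a ha p c hp hc hw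
    have hcJ := (hC hc).2
    have hlev : ∀ x y : Pos, ε * x 2 = J → -ε * arm ε x y 2 < 3 * (-(J - 1)) - 1 := by
      intro x y hx
      have := level_arm (s := x) (t := y) hε
      rw [hx] at this
      rw [neg_mul]
      omega
    rcases Finset.mem_insert.1 ha with rfl | ha
    · have := eq_of_within_arm hε hst.symm h2.symm hp hw (by rw [← h2]; omega)
      exact ⟨(this.resolve_right (hbel c hc)).trans hkt.symm, hlev _ _ (by rw [← h2, hsJ])⟩
    rcases Finset.mem_insert.1 ha with rfl | ha
    · have := eq_of_within_arm hε hst h2 hp hw (by omega)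
      exact ⟨(this.resolve_left (hbel c hc)).trans hkt.symm, hlev _ _ hsJ⟩
    · exact absurd hw (st.far a ha p c hp (hC hc).1 (hU hc) hcJ)
  case exposed =>
    intro U' hU' hkU' hconn
    have hconn' : NearConn (U ∪ U' : Finset Pos) := by
      rw [Finset.coe_union]
      exact st.conn.union hconn hs hkU' hsk
    have htJ : ε * t 2 = J := by rw [← h2, hsJ]
    -- The free cell `t` beside `s` is the contact: it touches the root `k`, and it remains free
    -- with `U ∪ U'` blocked.
    have := h.free_side w (U := U ∪ U') (s := s) (t := t)
      (Finset.union_subset st.sub fun c hc => (hC (hU' hc)).1)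
      (Finset.mem_union_left _ st.root) hconn' (Finset.mem_union_left _ hs) ht ?_ hst ?_
    · refine ⟨k, hkU', t, ?_, ?_⟩
      · rw [Set.union_assoc, ← Finset.coe_union]
        exact this.1
      · have := adj_above hε k
        rwa [hkt, above_neg_above, ← hkt] at this
    · rw [Finset.mem_union]
      rintro (h1 | h1)
      · exact htU h1
      · have := (hC (hU' h1)).2
        omega
    · intro c hc
      rw [htJ]
      rcases Finset.mem_union.1 hc with h1 | h1
      · exact st.le c h1
      · exact (hC (hU' h1)).2.le

end Settled

namespace Settled

variable {P : Finset Pos} {W B : Set Pos} {b : Pos} {ε lo hi J : ℤ} {C : Finset Pos} {c₀ : Pos}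
  {Q₀ : Set Pos} {A₀ U A : Finset Pos}

/-- The component of a pending cell near the last cell `s` can be built. -/
theorem exists_child {s k : Pos} (st : Settled ε C c₀ Q₀ A₀ J {s} U A)
    (h : Ctx P B b ε lo hi C c₀ Q₀ A₀) (w : World P W B b)
    (ih : ∀ C' ⊂ C, Solvable P W B b C') (hs : s ∈ U) (hsJ : ε * s 2 = J)
    (hsb : above (-ε) s ∈ C → above (-ε) s ∈ U) (hk : k ∈ C) (hkU : k ∉ U) (hkJ : ε * k 2 < J)
    (hsk : Near s k) : ∃ U' A', Builds W b A A' ∧ Settled ε C c₀ Q₀ A₀ J {s} U' A' ∧ U ⊂ U' := by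
  have hε := h.sign
  obtain ⟨t, ht, htU, hst, h2, hkt⟩ := st.exists_hanging h w hs hsJ hsb hk hkU hkJ hsk
  have htJ : ε * t 2 = J := by rw [← h2, hsJ]
  have hsC := st.sub hs
  have ls := h.level s hsC
  have ctx := st.child_ctx h w hs hsJ hsb ht htU hst h2 hkt hk hkU
  set D := C.filter fun c => ε * c 2 < J with hD
  have memD : ∀ {c}, c ∈ D ↔ c ∈ C ∧ ε * c 2 < J := by simp [hD]
  set C' := component D k with hC'
  have hkl : ε * k 2 = J - 1 := by rw [hkt, level_above hε, htJ]
  have hkD : k ∈ D := memD.2 ⟨hk, hkJ⟩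
  have hkC' : k ∈ C' := self_mem_component hkD
  have hC : ∀ {c}, c ∈ C' → c ∈ C ∧ ε * c 2 < J := fun hc => memD.1 (component_subset hc)
  have hU : ∀ {c}, c ∈ C' → c ∉ U := fun hc hcU => ctx.disj _ hc (.inr hcU)
  have hCss : C' ⊂ C :=
    ⟨fun c hc => (hC hc).1, fun hss => hU (hss h.root) st.root⟩
  -- the two tiles at the level `J`
  have b₁ : Builds W b A (insert (arm ε s t) A) :=
    st.place h w hs hsJ (inCell_arm hε hst) (by rw [level_arm hε, hsJ])
      ⟨_, st.center s hs hsJ, adj_arm_foot hst h2⟩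
  have hconn : NearConn (insert k U : Finset Pos) := st.conn.insert hs hsk
  have htk : t ∉ insert k U := by
    rw [Finset.mem_insert]
    rintro (rfl | h1)
    · omega
    · exact htU h1
  have b₂ : Builds W b (insert (arm ε s t) A) (insert (arm ε t s) (insert (arm ε s t) A)) := by
    refine h.place w (U := insert k U) (Finset.insert_subset hk st.sub) ?_ ?_ ht htJ (inCell_arm hε hst.symm)
      (by rw [level_arm hε, htJ]) ?_ ⟨_, Finset.mem_insert_self _ _, adj_arm_arm hst.symm h2.symm⟩
    · exact (st.filleted.insert (.inr hs) (inCell_arm hε hst)).mono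
        (Set.union_subset_union_right _ (by simp))
    · intro a ha ha'
      rcases Finset.mem_insert.1 ha with rfl | ha
      · rw [level_arm hε, hsJ]
      · exact (st.new a ha ha').1
    · refine (h.free_side w (Finset.insert_subset hk st.sub) (Finset.mem_insert_of_mem st.root)
        hconn (Finset.mem_insert_of_mem hs) ht htk hst ?_).2
      intro c hc
      rw [htJ]
      rcases Finset.mem_insert.1 hc with rfl | h1
      · exact hkJ.le
      · exact st.le c h1
  have b₃ : Builds W b (insert (arm ε t s) (insert (arm ε s t) A))
      (insert (arm ε t s) (insert (arm ε s t) A) ∪ tiles C') := by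
    -- In the reversed direction, the arm of `k` towards the cell below `s` is adjacent to the
    -- bridge tile `arm ε t s`.
    refine (ih C' hCss).builds w ctx (t := above (-ε) s) ?_ ?_
      ⟨_, Finset.mem_insert_self _ _, ?_⟩
    · rw [hkt]
      rw [adj_iff] at *
      simp only [pt_zero, pt_one, pt_two]
      omega
    · rw [hkt]
      simp only [pt_two, h2]
    · rw [hkt]
      simp only [adj_iff, arm, pt_zero, pt_one, pt_two, true_and, and_true]
      omega
  have hA : ∀ {p}, p ∈ A → p ∈ insert (arm ε t s) (insert (arm ε s t) A) ∪ tiles C' := fun hp =>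
    Finset.mem_union_left _ (Finset.mem_insert_of_mem (Finset.mem_insert_of_mem hp))
  refine ⟨U ∪ C', _, (b₁.trans b₂).trans b₃, ⟨⟨?_, ?_, ?_, ?_, ?_, ?_, ?_, ?_, ?_, ?_⟩, ?_, ?_⟩, ?_⟩
  · exact Finset.union_subset st.sub hCss.1
  · exact Finset.mem_union_left _ st.root
  · rw [Finset.coe_union]
    exact st.conn.union (component_nearConn hkD) hs hkC' hsk
  · intro c hc
    rcases Finset.mem_union.1 hc with hc | hc
    · exact st.le c hc
    · exact (hC hc).2.le
  · exact fun a ha => hA (st.subA ha)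
  · intro a ha ha'
    rcases Finset.mem_union.1 ha with ha | ha
    · rcases Finset.mem_insert.1 ha with rfl | ha
      · exact ⟨by rw [level_arm hε, htJ], t, ht, inCell_arm hε hst.symm⟩
      rcases Finset.mem_insert.1 ha with rfl | ha
      · exact ⟨by rw [level_arm hε, hsJ], s, hsC, inCell_arm hε hst⟩
      · exact st.new a ha ha'
    · obtain ⟨c, hc, hac⟩ := mem_tiles.1 ha
      refine ⟨?_, c, (hC hc).1, hac⟩
      have := (hC hc).2
      obtain ⟨-, -, n⟩ := hac
      rcases hε with rfl | rfl <;> omega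
  · have hQ : Q₀ ∪ (U : Set Pos) ⊆ Q₀ ∪ ((U ∪ C' : Finset Pos) : Set Pos) :=
      Set.union_subset_union_right _ (by simp)
    have hkQ : k ∈ Q₀ ∪ ((U ∪ C' : Finset Pos) : Set Pos) := by
      right; simp [hkC']
    -- The bridge tile in the unblocked cell `t` is at the edge between the sides facing `s` and
    -- `k`, both blocked.
    refine Filleted.union (Filleted.insert_arm ((st.filleted.mono hQ).insert (hQ (.inr hs))
      (inCell_arm hε hst)) hε hst h2 (hQ (.inr hs)) (hkt ▸ hkQ)) ?_
    intro a ha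
    obtain ⟨c, hc, hac⟩ := mem_tiles.1 ha
    exact ⟨c, by right; simp [hc], hac⟩
  · intro c hc hl p hp
    rcases Finset.mem_union.1 hc with hc | hc
    · exact hA (st.full c hc hl p hp)
    · exact Finset.mem_union_right _ (mem_tiles.2 ⟨c, hc, hp⟩)
  · intro c hc hl x hx hcx hlx
    rcases Finset.mem_union.1 hc with hc | hc
    · exact Finset.mem_union_left _ (st.closed c hc hl x hx hcx hlx)
    · exact Finset.mem_union_right _ (component_step hc hcx (memD.2 ⟨hx, hlx⟩))
  · intro a ha p c hp hc hcU hl hw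
    rw [Finset.mem_union, not_or] at hcU
    have hcs : c ≠ above (-ε) s := by
      rintro rfl
      exact hcU.1 (hsb hc)
    have hcts : c ≠ above (-ε) t := by
      rw [← hkt]
      rintro rfl
      exact hcU.2 hkC'
    rcases Finset.mem_union.1 ha with ha | ha
    · rcases Finset.mem_insert.1 ha with rfl | ha
      · exact (eq_of_within_arm hε hst.symm h2.symm hp hw (by omega)).elim hcts hcs
      rcases Finset.mem_insert.1 ha with rfl | ha
      · exact (eq_of_within_arm hε hst h2 hp hw (by omega)).elim hcs hcts
      · exact st.far a ha p c hp hc hcU.1 hl hw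
    · obtain ⟨d, hd, had⟩ := mem_tiles.1 ha
      exact h.not_near w (by omega)
        (fun x hx _ y hy hxy hl => component_step hx hxy (memD.2 ⟨hy, hl⟩)) hd (hC hd).1 hc hcU.2
        (hC hd).2 hl (hw.near hp had).symm
  · intro c hc hl
    rcases Finset.mem_union.1 hc with hc | hc
    · exact hA (st.center c hc hl)
    · exact absurd hl (hC hc).2.ne
  · intro c hc hcs hl x hx hxU hlx
    rw [Finset.mem_union, not_or] at hxU
    rcases Finset.mem_union.1 hc with hc | hc
    · exact st.sep c hc hcs hl x hx hxU.1 hlx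
    · exact absurd hl (hC hc).2.ne
  · exact ⟨Finset.subset_union_left, fun hss => hU hkC' (hss (Finset.mem_union_right _ hkC'))⟩

/-- All pending cells near the last cell `s` can be built. -/
theorem exists_children {s : Pos} (h : Ctx P B b ε lo hi C c₀ Q₀ A₀) (w : World P W B b)
    (ih : ∀ C' ⊂ C, Solvable P W B b C') (hsJ : ε * s 2 = J) (n : ℕ) :
    ∀ U A, (C \ U).card ≤ n → Settled ε C c₀ Q₀ A₀ J {s} U A → s ∈ U →
      (above (-ε) s ∈ C → above (-ε) s ∈ U) →
      ∃ U' A', Builds W b A A' ∧ Settled ε C c₀ Q₀ A₀ J ∅ U' A' ∧ U ⊆ U' := by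
  induction n with
  | zero =>
    intro U A hn st hs hsb
    refine ⟨U, A, .refl, ⟨st.toStage, st.center, ?_⟩, subset_rfl⟩
    intro k hk _ _ c hc hcU
    exact absurd (Finset.sdiff_eq_empty_iff_subset.1 (Finset.card_eq_zero.1 (by omega)) hc) hcU
  | succ n hind =>
    intro U A hn st hs hsb
    by_cases hex : ∃ k ∈ C, k ∉ U ∧ ε * k 2 < J ∧ Near s k
    · obtain ⟨k, hk, hkU, hkJ, hsk⟩ := hex
      obtain ⟨U', A', hb, st', hss⟩ := st.exists_child h w ih hs hsJ hsb hk hkU hkJ hsk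
      have hlt : (C \ U').card < (C \ U).card := by
        rw [Finset.card_sdiff_of_subset st.sub, Finset.card_sdiff_of_subset st'.sub]
        have h1 := Finset.card_lt_card hss
        have h2 := Finset.card_le_card st'.sub
        omega
      obtain ⟨U'', A'', hb', st'', hss'⟩ := hind U' A' (by omega) st' (hss.1 hs)
        (fun hC => hss.1 (hsb hC))
      exact ⟨U'', A'', hb.trans hb', st'', hss.1.trans hss'⟩
    · refine ⟨U, A, .refl, ⟨st.toStage, st.center, ?_⟩, subset_rfl⟩
      intro k hk _ hkJ c hc hcU hl hn
      by_cases hks : k = s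
      · exact hex ⟨c, hc, hcU, hl, hks ▸ hn⟩
      · exact st.sep k hk hks hkJ c hc hcU hl hn

/-- The blocked cells can be extended until they are closed under adjacency up to the level
`J`. -/
theorem exists_closed (h : Ctx P B b ε lo hi C c₀ Q₀ A₀) (w : World P W B b)
    (ih : ∀ C' ⊂ C, Solvable P W B b C') (n : ℕ) :
    ∀ U A, (C \ U).card ≤ n → Settled ε C c₀ Q₀ A₀ J ∅ U A →
      ∃ U' A', Builds W b A A' ∧ Settled ε C c₀ Q₀ A₀ J ∅ U' A' ∧
        ∀ k ∈ U', ∀ t ∈ C, grid.Adj k t → ε * t 2 ≤ J → t ∈ U' := by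
  induction n with
  | zero =>
    intro U A hn st
    refine ⟨U, A, .refl, st, fun k hk t ht _ _ => ?_⟩
    exact Finset.sdiff_eq_empty_iff_subset.1 (Finset.card_eq_zero.1 (by omega)) ht
  | succ n hind =>
    intro U A hn st
    by_cases hex : ∃ s ∈ C, s ∉ U ∧ ε * s 2 = J ∧ ∃ k ∈ U, grid.Adj k s
    · obtain ⟨s, hs, hsU, hsJ, k, hk, hks⟩ := hex
      obtain ⟨A', hb, st', hsb⟩ := st.exists_insert h w hs hsU hsJ hk hks
      obtain ⟨U'', A'', hb', st'', hss⟩ := exists_children h w ih hsJ _ _ _ le_rfl st'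
        (Finset.mem_insert_self _ _) (fun hC => Finset.mem_insert_of_mem (hsb hC))
      have hlt : (C \ U'').card < (C \ U).card := by
        rw [Finset.card_sdiff_of_subset st.sub, Finset.card_sdiff_of_subset st''.sub]
        have h1 := Finset.card_le_card hss
        rw [Finset.card_insert_of_notMem hsU] at h1
        have h2 := Finset.card_le_card st''.sub
        omega
      obtain ⟨U₃, A₃, hb₃, st₃, hcl⟩ := hind U'' A'' (by omega) st''
      exact ⟨U₃, A₃, (hb.trans hb').trans hb₃, st₃, hcl⟩
    · refine ⟨U, A, .refl, st, fun k hk t ht hkt hl => ?_⟩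
      by_contra htU
      rcases hl.lt_or_eq with hl | hl
      · rcases (st.le k hk).lt_or_eq with hkl | hkl
        · exact htU (st.closed k hk hkl t ht hkt hl)
        · exact st.sep k hk (by simp) hkl t ht htU hl (near_of_adj hkt)
      · exact hex ⟨t, ht, htU, hl, k, hk, hkt⟩

end Settled

/-! ### Filling the cells of a level -/

/-- The order in which the tiles of the cells at the level `J` are placed: layer by layer, inside
the lowest layer away from the middle of the cell, and inside the highest layer towards the
middle. -/
def priority (ε J : ℤ) (p : Pos) : ℤ :=
  -- The values within a layer are at most 3, so with the factor 4 the layer decides first.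
  4 * (ε * p 2) +
    if ε * p 2 = 3 * J + 1 then if 3 ∣ p 1 then if 3 ∣ p 0 then 3 else 2 else 0
    else (if 3 ∣ p 0 then 0 else 1) + if 3 ∣ p 1 then 0 else 1

/-- Each tile except for the foot of its cell has a neighbor of smaller priority. -/
theorem exists_priority_lt {ε J : ℤ} (hε : ε = 1 ∨ ε = -1) {c p : Pos} (hc : ε * c 2 = J)
    (hp : InCell p c) (hf : p ≠ foot ε c) :
    ∃ r, InCell r c ∧ grid.Adj p r ∧ priority ε J r < priority ε J p := by
  have hf' : ¬ (p 0 = 3 * c 0 ∧ p 1 = 3 * c 1 ∧ p 2 = 3 * c 2 - ε) := by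
    rintro ⟨h0, h1, h2⟩
    exact hf (pos_ext h0 h1 h2)
  unfold InCell at hp
  -- In the bottom layer the neighbor is one step closer to the foot; in the other layers it is the
  -- tile underneath.
  by_cases h2 : p 2 = 3 * c 2 - ε
  · have hl : ε * p 2 = 3 * J - 1 := by rw [h2]; rcases hε with rfl | rfl <;> omega
    by_cases h0 : p 0 = 3 * c 0
    · refine ⟨pt (p 0) (3 * c 1) (p 2), ?_, ?_, ?_⟩
      · simp only [InCell, pt_zero, pt_one, pt_two]; omega
      · simp only [adj_iff, pt_zero, pt_one, pt_two, true_and, and_true]; omega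
      · simp only [priority, pt_zero, pt_one, pt_two, hl]
        split_ifs <;> omega
    · refine ⟨pt (3 * c 0) (p 1) (p 2), ?_, ?_, ?_⟩
      · simp only [InCell, pt_zero, pt_one, pt_two]; omega
      · simp only [adj_iff, pt_zero, pt_one, pt_two, true_and, and_true]; omega
      · simp only [priority, pt_zero, pt_one, pt_two, hl]
        split_ifs <;> omega
  · have hl : ε * (p 2 - ε) = ε * p 2 - 1 := by rcases hε with rfl | rfl <;> ring
    have hl' : ε * p 2 ≤ 3 * J + 1 := by rcases hε with rfl | rfl <;> omega
    refine ⟨pt (p 0) (p 1) (p 2 - ε), ?_, ?_, ?_⟩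
    · simp only [InCell, pt_zero, pt_one, pt_two]; omega
    · simp only [adj_iff, pt_zero, pt_one, pt_two, true_and, and_true]; omega
    · simp only [priority, pt_zero, pt_one, pt_two, hl]
      generalize ε * p 2 = z at *
      split_ifs <;> omega

namespace Settled

variable {P : Finset Pos} {W B : Set Pos} {b : Pos} {ε lo hi J : ℤ} {C : Finset Pos} {c₀ : Pos}
  {Q₀ : Set Pos} {A₀ U A : Finset Pos}

/-- The cells at the level `J` can be completed. -/
theorem fill (st : Settled ε C c₀ Q₀ A₀ J ∅ U A) (h : Ctx P B b ε lo hi C c₀ Q₀ A₀)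
    (w : World P W B b) (n : ℕ) :
    ∀ A', (tiles (U.filter fun c => ε * c 2 = J) \ A').card ≤ n → A ⊆ A' →
      A' ⊆ A ∪ tiles (U.filter fun c => ε * c 2 = J) →
      (∀ a ∈ A', a ∉ A₀ → ε * a 2 ≤ 3 * J - 1 ∨
        ∀ p ∈ tiles (U.filter fun c => ε * c 2 = J), p ∉ A' → priority ε J a ≤ priority ε J p) →
      Builds W b A' (A ∪ tiles (U.filter fun c => ε * c 2 = J)) := by
  have hε := h.sign
  set T := tiles (U.filter fun c => ε * c 2 = J) with hT
  have memT : ∀ {p}, p ∈ T ↔ ∃ c, (c ∈ U ∧ ε * c 2 = J) ∧ InCell p c := by simp [hT, mem_tiles]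
  induction n with
  | zero =>
    intro A' hn hA hA' _
    have : T ⊆ A' := Finset.sdiff_eq_empty_iff_subset.1 (Finset.card_eq_zero.1 (by omega))
    rw [hA'.antisymm (Finset.union_subset hA this)]
    exact .refl
  | succ n ih =>
    intro A' hn hA hA' hord
    by_cases hne : (T \ A').Nonempty
    swap
    · rw [Finset.not_nonempty_iff_eq_empty, Finset.sdiff_eq_empty_iff_subset] at hne
      rw [hA'.antisymm (Finset.union_subset hA hne)]
      exact .refl
    obtain ⟨p, hp, hmin⟩ := Finset.exists_min_image _ (priority ε J) hne
    obtain ⟨hpT, hpA⟩ := Finset.mem_sdiff.1 hp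
    obtain ⟨c, ⟨hc, hcJ⟩, hpc⟩ := memT.1 hpT
    have hmin' : ∀ r ∈ T, priority ε J r < priority ε J p → r ∈ A' := by
      intro r hr hlt
      by_contra hrA
      exact absurd (hmin r (Finset.mem_sdiff.2 ⟨hr, hrA⟩)) (not_le.2 hlt)
    have hfil : Filleted A' (Q₀ ∪ U) := by
      intro a ha d hd
      rcases Finset.mem_union.1 (hA' ha) with ha | ha
      · exact st.filleted a ha d hd
      · obtain ⟨e, ⟨he, -⟩, hae⟩ := memT.1 ha
        exact .inl (.inr (hd.unique hae ▸ he))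
    have hpl : 3 * J - 1 ≤ ε * p 2 ∧ ε * p 2 ≤ 3 * J + 1 := by
      obtain ⟨-, -, h2⟩ := hpc
      rcases hε with rfl | rfl <;> omega
    have hnew : ∀ a ∈ A', a ∉ A₀ → ε * a 2 ≤ 3 * J - 1 ∨ priority ε J a ≤ priority ε J p :=
      fun a ha ha' => (hord a ha ha').imp_right fun h => h p hpT hpA
    have step : AddStep W b A' p := by
      refine h.addStep w st.sub hfil (st.sub hc) hpc ?_ ?_ ?_ hpA ?_
      · exact h.free_above w st.sub st.root st.conn hc fun k hk => by rw [hcJ]; exact st.le k hk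
      · intro a ha ha'
        rcases hnew a ha ha' with h1 | h1
        · omega
        · unfold priority at h1
          generalize ε * p 2 = z at *
          generalize ε * a 2 = y at *
          split_ifs at h1 <;> omega
      -- Arriving tiles cross over the middle and along the middle row of the top layer, which is
      -- why these places come last there.
      · intro a ha ha' h2 h1
        have hal : ε * a 2 = 3 * J + 1 := by
          rw [h2]; rcases hε with rfl | rfl <;> omega
        have h3 := (hnew a ha ha').resolve_left (by omega)
        have hpa : ¬ (p 0 = a 0 ∧ p 1 = a 1 ∧ p 2 = a 2) := by
          rintro ⟨e0, e1, e2⟩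
          rw [pos_ext e0 e1 e2] at hpA
          exact hpA ha
        have hp2 : ε * p 2 = 3 * J + 1 → p 2 = a 2 := by
          intro h4
          rcases hε with rfl | rfl <;> omega
        obtain ⟨q0, q1, -⟩ := hpc
        unfold priority at h3
        rw [hal] at h3
        generalize ε * p 2 = z at *
        split_ifs at h3 <;> omega
      · obtain ⟨r, hr, hpr, hlt⟩ := exists_priority_lt hε hcJ hpc (by
          rintro rfl
          exact hpA (hA (st.center c hc hcJ)))
        exact ⟨r, hmin' r (memT.2 ⟨c, ⟨hc, hcJ⟩, hr⟩) hlt, hpr⟩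
    refine Relation.ReflTransGen.head ⟨p, step, rfl⟩ (ih _ ?_ ?_ ?_ ?_)
    · have : (T \ insert p A').card < (T \ A').card :=
        Finset.card_lt_card ⟨Finset.sdiff_subset_sdiff subset_rfl (Finset.subset_insert _ _),
          fun hss => (Finset.mem_sdiff.1 (hss hp)).2 (Finset.mem_insert_self _ _)⟩
      omega
    · exact hA.trans (Finset.subset_insert _ _)
    · exact Finset.insert_subset (Finset.mem_union_right _ hpT) hA'
    · intro a ha ha'
      rcases Finset.mem_insert.1 ha with rfl | ha
      · refine .inr fun q hq hqA => hmin q (Finset.mem_sdiff.2 ⟨hq, fun h => hqA ?_⟩)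
        exact Finset.mem_insert_of_mem h
      · refine (hord a ha ha').imp_right fun h q hq hqA => h q hq fun h => hqA ?_
        exact Finset.mem_insert_of_mem h

/-- When the cells up to the level `J` are completed, the next level can be begun. -/
theorem succ (st : Settled ε C c₀ Q₀ A₀ J ∅ U A) (h : Ctx P B b ε lo hi C c₀ Q₀ A₀)
    (w : World P W B b) (hJ : J ≤ hi)
    (hcl : ∀ k ∈ U, ∀ t ∈ C, grid.Adj k t → ε * t 2 ≤ J → t ∈ U) :
    Settled ε C c₀ Q₀ A₀ (J + 1) ∅ U (A ∪ tiles (U.filter fun c => ε * c 2 = J)) := by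
  have hε := h.sign
  have memT : ∀ {p}, p ∈ tiles (U.filter fun c => ε * c 2 = J) ↔
      ∃ c, (c ∈ U ∧ ε * c 2 = J) ∧ InCell p c := by simp [mem_tiles]
  have hnew : ∀ a ∈ A ∪ tiles (U.filter fun c => ε * c 2 = J), a ∉ A₀ →
      ε * a 2 ≤ 3 * (J + 1) - 1 ∧ ∃ c ∈ U, InCell a c := by
    intro a ha ha'
    rcases Finset.mem_union.1 ha with ha | ha
    · obtain ⟨h1, c, hc, hac⟩ := st.new a ha ha'
      refine ⟨by omega, c, ?_, hac⟩
      -- A bridge tile outside of the blocked cells has a blocked horizontal neighbor cell; by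
      -- closure up to `J` its own cell is in `U` after all.
      rcases st.filleted a ha c hac with hQ | ⟨e, x, y, he, hxy, rfl, hq, -⟩
      · exact hQ.resolve_left (h.disj c hc)
      · have hadj : grid.Adj c (pt (c 0 + x) (c 1 + y) (c 2)) := by
          simp only [adj_iff, pt_zero, pt_one, pt_two, true_and, and_true]; omega
        have hqU := hq.resolve_left fun hq => h.not_adj c hc _ hq hadj
        exact hcl _ hqU c hc hadj.symm (st.le (pt (c 0 + x) (c 1 + y) (c 2)) hqU)
    · obtain ⟨c, ⟨hc, hcJ⟩, hac⟩ := memT.1 ha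
      refine ⟨?_, c, hc, hac⟩
      obtain ⟨-, -, h2⟩ := hac
      rcases hε with rfl | rfl <;> omega
  refine ⟨⟨st.sub, st.root, st.conn, ?_, ?_, ?_, ?_, ?_, ?_, ?_⟩, ?_, ?_⟩
  · intro k hk
    have := st.le k hk
    omega
  · exact st.subA.trans Finset.subset_union_left
  · intro a ha ha'
    obtain ⟨h1, c, hc, hac⟩ := hnew a ha ha'
    exact ⟨h1, c, st.sub hc, hac⟩
  · refine st.filleted.union fun a ha => ?_
    obtain ⟨c, ⟨hc, -⟩, hac⟩ := memT.1 ha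
    exact ⟨c, .inr hc, hac⟩
  · intro k hk hl p hp
    rcases (st.le k hk).lt_or_eq with hkJ | hkJ
    · exact Finset.mem_union_left _ (st.full k hk hkJ p hp)
    · exact Finset.mem_union_right _ (memT.2 ⟨k, ⟨hk, hkJ⟩, hp⟩)
  · intro k hk _ t ht hkt hl
    exact hcl k hk t ht hkt (by omega)
  · intro a ha p c hp hc hcU hl hw
    by_cases haA : a ∈ A₀
    · exact hcU ((h.far a haA p c hp hc hw).1 ▸ st.root)
    · obtain ⟨-, d, hd, had⟩ := hnew a ha haA
      refine h.not_near w (J := J + 1) (by omega)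
        (fun k hk _ t ht hkt hl => hcl k hk t ht hkt (by omega)) hd (st.sub hd) hc hcU ?_ hl
        (hw.near hp had).symm
      have := st.le d hd
      omega
  · intro k hk hkJ
    have := st.le k hk
    omega
  · intro k hk _ hkJ
    have := st.le k hk
    omega

/-- No cell of `C` is below `lo`, so all conditions on lower levels are vacuous. -/
theorem start (h : Ctx P B b ε lo hi C c₀ Q₀ A₀) {R : Finset Pos}
    (hR : ∀ r ∈ R, InCell r c₀ ∧ ε * r 2 = 3 * lo - 1) (hf : foot ε c₀ ∈ R) :
    Settled ε C c₀ Q₀ A₀ lo ∅ {c₀} (A₀ ∪ R) := by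
  have hlt : ∀ c ∈ C, ¬ ε * c 2 < lo := fun c hc => not_lt.2 (h.level c hc).1
  have hl := h.root_level
  refine ⟨⟨Finset.singleton_subset_iff.2 h.root, Finset.mem_singleton_self _, ?_, ?_,
    Finset.subset_union_left, ?_, ?_, ?_, ?_, ?_⟩, ?_, ?_⟩
  · rw [Finset.coe_singleton]
    exact nearConn_singleton c₀
  · intro k hk
    rw [Finset.mem_singleton.1 hk, hl]
  · intro a ha ha'
    obtain ⟨h1, h2⟩ := hR a ((Finset.mem_union.1 ha).resolve_left ha')
    exact ⟨h2.le, c₀, h.root, h1⟩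
  · rw [Finset.coe_singleton, Set.union_singleton]
    exact h.filleted.union fun a ha => ⟨c₀, Set.mem_insert _ _, (hR a ha).1⟩
  · intro k hk hkl
    rw [Finset.mem_singleton.1 hk] at hkl
    omega
  · exact fun _ _ _ t ht _ hl => absurd hl (hlt t ht)
  · exact fun _ _ _ c _ hc _ hl => absurd hl (hlt c hc)
  · intro k hk _
    rw [Finset.mem_singleton.1 hk]
    exact Finset.mem_union_right _ hf
  · exact fun _ _ _ _ c hc _ hl => absurd hl (hlt c hc)

end Settled

/-- Strong induction on `C` provides the hanging components, which are proper subsets; an inner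
induction raises the level, closing and then filling each one. At the level `hi + 1` every cell is a
lower one, so connectedness of `C` and closure leave nothing pending. -/
theorem solvable {P : Finset Pos} {W B : Set Pos} {b : Pos} (w : World P W B b) (C : Finset Pos) :
    Solvable P W B b C := by
  induction C using Finset.strongInduction with
  | H C ih =>
  intro ε lo hi c₀ Q₀ A₀ R h hR hf
  have hle : lo ≤ hi := by
    have := h.level c₀ h.root
    omega
  have key : ∀ n : ℕ, lo + n ≤ hi + 1 → ∃ U A, Builds W b (A₀ ∪ R) A ∧
      Settled ε C c₀ Q₀ A₀ (lo + n) ∅ U A := by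
    intro n
    induction n with
    | zero =>
      intro _
      exact ⟨_, _, .refl, by simpa using Settled.start h hR hf⟩
    | succ n hind =>
      intro hn
      push_cast at hn ⊢
      obtain ⟨U, A, hb, st⟩ := hind (by omega)
      obtain ⟨U', A', hb', st', hcl⟩ := Settled.exists_closed h w ih _ U A le_rfl st
      have st'' := st'.succ h w (by omega) hcl
      rw [add_assoc] at st''
      refine ⟨U', _, (hb.trans hb').trans ?_, st''⟩
      exact st'.fill h w _ A' le_rfl subset_rfl Finset.subset_union_left
        fun a ha ha' => .inl (st'.new a ha ha').1
  obtain ⟨U, A, hb, st⟩ := key (hi + 1 - lo).toNat (by omega)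
  rw [show lo + ((hi + 1 - lo).toNat : ℤ) = hi + 1 by omega] at st
  have hlt : ∀ c ∈ C, ε * c 2 < hi + 1 := fun c hc => by
    have := h.level c hc
    omega
  have hU : C ⊆ U := by
    intro c hc
    have := h.conn c₀ h.root c hc
    clear hc
    induction this with
    | refl => exact st.root
    | tail _ hxy ih' =>
      exact st.closed _ ih' (hlt _ (st.sub ih')) _ hxy.2 hxy.1 (hlt _ hxy.2)
  have hA : A = A₀ ∪ tiles C := by
    refine Finset.Subset.antisymm (fun a ha => ?_) (Finset.union_subset st.subA fun a ha => ?_)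
    · by_cases ha' : a ∈ A₀
      · exact Finset.mem_union_left _ ha'
      · obtain ⟨-, c, hc, hac⟩ := st.new a ha ha'
        exact Finset.mem_union_right _ (mem_tiles.2 ⟨c, hc, hac⟩)
    · obtain ⟨c, hc, hac⟩ := mem_tiles.1 ha
      exact st.full c (hU hc) (hlt c hc) a hac
  rwa [← hA]

/-! ### The workspace -/

/-- A monotone path; `r` is needed only for increasing steps in the box between `b` and `c`. -/
theorem reflTransGen_of_le {r : Pos → Pos → Prop} {b : Pos} (n : ℕ) :
    ∀ c : Pos, c 0 - b 0 + (c 1 - b 1) + (c 2 - b 2) = n →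
      (b 0 ≤ c 0 ∧ b 1 ≤ c 1 ∧ b 2 ≤ c 2) →
      (∀ p q : Pos, grid.Adj p q → (b 0 ≤ p 0 ∧ b 1 ≤ p 1 ∧ b 2 ≤ p 2) →
        (q 0 ≤ c 0 ∧ q 1 ≤ c 1 ∧ q 2 ≤ c 2) → (p 0 ≤ q 0 ∧ p 1 ≤ q 1 ∧ p 2 ≤ q 2) → r p q) →
      Relation.ReflTransGen r b c := by
  induction n with
  | zero =>
    intro c hn hle _
    rw [show c = b from pos_ext (by omega) (by omega) (by omega)]
  | succ n ih =>
    intro c hn hle hr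
    have key : ∀ d : Pos, grid.Adj d c → (b 0 ≤ d 0 ∧ b 1 ≤ d 1 ∧ b 2 ≤ d 2) →
        (d 0 ≤ c 0 ∧ d 1 ≤ c 1 ∧ d 2 ≤ c 2) → c 0 + c 1 + c 2 = d 0 + d 1 + d 2 + 1 →
        Relation.ReflTransGen r b c := by
      intro d hd hbd hdc hs
      refine (ih d (by push_cast at hn; omega) hbd fun p q ha hp hq hpq => ?_).tail
        (hr d c hd hbd (by omega) hdc)
      exact hr p q ha hp (by omega) hpq
    by_cases h0 : b 0 < c 0
    · refine key (pt (c 0 - 1) (c 1) (c 2)) ?_ ?_ ?_ ?_ <;>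
        simp only [adj_iff, pt_zero, pt_one, pt_two, true_and, and_true] <;> omega
    by_cases h1 : b 1 < c 1
    · refine key (pt (c 0) (c 1 - 1) (c 2)) ?_ ?_ ?_ ?_ <;>
        simp only [adj_iff, pt_zero, pt_one, pt_two, true_and, and_true] <;> omega
    · refine key (pt (c 0) (c 1) (c 2 - 1)) ?_ ?_ ?_ ?_ <;>
        simp only [adj_iff, pt_zero, pt_one, pt_two, true_and, and_true] <;> omega

namespace IsPolycube

variable {P : Finset Pos}

theorem reflTransGen (hP : IsPolycube P) {a c : Pos} (ha : a ∈ P) (hc : c ∈ P) :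
    Relation.ReflTransGen (fun x y => grid.Adj x y ∧ y ∈ P) a c := by
  obtain ⟨p⟩ := hP.preconnected ⟨a, ha⟩ ⟨c, hc⟩
  have : ∀ {u v : (P : Set Pos)}, (grid.induce (P : Set Pos)).Walk u v →
      Relation.ReflTransGen (fun x y => grid.Adj x y ∧ y ∈ P) u.1 v.1 := by
    intro u v p
    induction p with
    | nil => exact .refl
    | @cons u v w hadj _ ih => exact .head ⟨hadj, v.2⟩ ih
  exact this p

/-- A simple path in `P` has fewer than `P.card` steps, and each changes a coordinate by at most 1.
-/
theorem abs_sub_le (hP : IsPolycube P) {a c : Pos} (ha : a ∈ P) (hc : c ∈ P) (i : Fin 3) :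
    |a i - c i| ≤ P.card := by
  classical
  have : ∀ {u v : (P : Set Pos)} (p : (grid.induce (P : Set Pos)).Walk u v),
      |u.1 i - v.1 i| ≤ p.length := by
    intro u v p
    induction p with
    | nil => simp
    | @cons u v w hadj p ih =>
      have h1 : grid.Adj u.1 v.1 := hadj
      have h2 : |u.1 i - v.1 i| ≤ 1 := by
        have h3 : dist1 u.1 v.1 = 1 := h1
        rw [← h3]
        exact Finset.single_le_sum (f := fun i => |u.1 i - v.1 i|) (fun _ _ => abs_nonneg _)
          (Finset.mem_univ i)
      rw [SimpleGraph.Walk.length_cons]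
      push_cast
      linarith [_root_.abs_sub_le (u.1 i) (v.1 i) (w.1 i)]
  obtain ⟨p⟩ := hP.preconnected ⟨a, ha⟩ ⟨c, hc⟩
  have h1 := this p.toPath.1
  have h2 := p.toPath.2.length_lt
  simp only [Finset.coe_sort_coe, Fintype.card_coe] at h2
  simp only at h1
  omega

end IsPolycube

/-- The shift by 1 arises because the cubes of `scaledCopy` begin at `3c`, whereas those of `InCell`
are centered there. -/
theorem mem_scaledCopy {P : Finset Pos} {p : Pos} :
    p ∈ scaledCopy 3 P ↔ ∃ c ∈ P, InCell (p - 1) c := by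
  simp only [scaledCopy, Finset.mem_biUnion, Fintype.mem_piFinset, Finset.mem_Ico,
    Fin.forall_fin_succ, InCell, Pi.sub_apply, Pi.one_apply]
  refine exists_congr fun c => and_congr_right fun _ => ?_
  simp
  omega

theorem card_scaledCopy (P : Finset Pos) : (scaledCopy 3 P).card = P.card * 27 := by
  unfold scaledCopy
  rw [Finset.card_biUnion]
  · simp [Fintype.card_piFinset]
  · intro c _ d _ hne
    rw [Function.onFun, Finset.disjoint_left]
    intro p hp hp'
    refine hne (funext fun i => ?_)
    have h1 := Fintype.mem_piFinset.1 hp i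
    have h2 := Fintype.mem_piFinset.1 hp' i
    simp only [Finset.mem_Ico] at h1 h2
    push_cast at h1 h2
    omega

theorem adj_add {p q v : Pos} : grid.Adj (p + v) (q + v) ↔ grid.Adj p q := by
  change dist1 _ _ = 1 ↔ dist1 _ _ = 1
  simp [dist1]

/-- Shapes that are built in a translate of the workspace are assembled. -/
theorem Builds.assembled {n : ℕ} {v b : Pos} {A A' T : Finset Pos}
    (h : Builds {p | p + v ∈ workspace n} b A A')
    (hT : ∀ A ⊆ T, Relation.ReflTransGen (CMove {p | p + v ∈ workspace n} A) (-v) (center b))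
    (hA : Assembled n (A.image fun p => p + v)) (hA' : A' ⊆ T) :
    Assembled n (A'.image fun p => p + v) := by
  induction h with
  | refl => exact hA
  | @tail D E _ hDE ih =>
    obtain ⟨p, ⟨hmove, hp, r, hr, hpr⟩, rfl⟩ := hDE
    have hD := (Finset.subset_insert p D).trans hA'
    rw [Finset.image_insert]
    refine .step (ih hD) ⟨?_, ?_, r + v, Finset.mem_image_of_mem _ hr, adj_add.2 hpr⟩
    · have := (hT D hD).trans hmove
      have key : ∀ q, Relation.ReflTransGen (CMove {p | p + v ∈ workspace n} D) (-v) q →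
          Relation.ReflTransGen (Move n (D.image fun p => p + v)) 0 (q + v) := by
        intro q hq
        induction hq with
        | refl => rw [neg_add_cancel]
        | @tail x y _ hxy ih' =>
          obtain ⟨h1, h2, h3, h4, h5⟩ := hxy
          refine ih'.tail ⟨h1, h2, adj_add.2 h3, by simpa using h4, fun s hs hsD => ?_⟩
          obtain ⟨s, hs', rfl⟩ := Finset.mem_image.1 hsD
          exact h5 s (adj_add.1 hs) hs'
      exact key p this
    · simpa using hp

/-- The cells at distance at most `M` of `c`. -/
def box (c : Pos) (M : ℤ) : Set Pos :=
  {p | (c 0 - M ≤ p 0 ∧ p 0 ≤ c 0 + M) ∧ (c 1 - M ≤ p 1 ∧ p 1 ≤ c 1 + M) ∧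
    c 2 - M ≤ p 2 ∧ p 2 ≤ c 2 + M}

section

variable {P : Finset Pos} {c₀ : Pos}

/-- The extent of `P` is at most its cardinality; one more layer of cells gives room around it. With
`27 * P.card` tiles the workspace contains this box when the foot of `c₀` is the seed. -/
theorem world (hP : IsPolycube P) (hnd : NonDegenerate P) (hc : c₀ ∈ P)
    (hmin : ∀ c ∈ P, c₀ 2 ≤ c 2) :
    World P {p | p + (seed (scaledCopy 3 P).card - foot 1 c₀) ∈ workspace (scaledCopy 3 P).card}
      (box c₀ (P.card + 1))
      (pt (c₀ 0 - (P.card + 1)) (c₀ 1 - (P.card + 1)) (c₀ 2 - (P.card + 1))) := by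
  have hpos : 0 < P.card := Finset.card_pos.2 ⟨c₀, hc⟩
  refine ⟨hnd, ?_, ?_, ?_, ?_⟩
  · simp only [box, Set.mem_ofPred_eq, pt_zero, pt_one, pt_two]; omega
  · intro j hj
    have := hmin _ hj
    simp only [pt_two] at this
    omega
  · intro p hp q hpq
    have h0 := abs_le.1 (hP.abs_sub_le hp hc 0)
    have h1 := abs_le.1 (hP.abs_sub_le hp hc 1)
    have h2 := abs_le.1 (hP.abs_sub_le hp hc 2)
    simp only [box, Set.mem_ofPred_eq, Near] at *
    omega
  · intro c hcB p hpc
    simp only [box, Set.mem_ofPred_eq, InCell, workspace, seed, foot, Fin.forall_fin_succ,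
      Pi.add_apply, Pi.sub_apply] at *
    simp only [Fin.succ_zero_eq_one, Fin.succ_one_eq_two, pt_zero, pt_one, pt_two,
      IsEmpty.forall_iff, and_true, card_scaledCopy]
    push_cast
    omega

/-- At the outset nothing is placed or blocked. The contact with the free region is the cell below
`c₀`, reached by a monotone path below all of `P`. -/
theorem ctx (hP : IsPolycube P) (hc : c₀ ∈ P) (hmin : ∀ c ∈ P, c₀ 2 ≤ c 2) :
    Ctx P (box c₀ (P.card + 1))
      (pt (c₀ 0 - (P.card + 1)) (c₀ 1 - (P.card + 1)) (c₀ 2 - (P.card + 1))) 1 (c₀ 2)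
      (c₀ 2 + P.card) P c₀ ∅ ∅ where
  sign := .inl rfl
  sub := subset_rfl
  conn := fun _ ha _ hc => hP.reflTransGen ha hc
  closed := fun _ _ t ht _ _ _ => ht
  level := by
    intro k hk
    have h2 := abs_le.1 (hP.abs_sub_le hk hc 2)
    have := hmin k hk
    omega
  root := hc
  root_level := one_mul _
  subQ := Set.empty_subset _
  disj := by simp
  not_adj := by simp
  pinch := by simp
  unique := by simp
  filleted := by simp [Filleted]
  far := by simp
  exposed := by
    intro U hU hcU _
    refine ⟨c₀, hcU, above (-1) c₀, ?_, ?_⟩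
    · refine reflTransGen_of_le (2 * (P.card + 1) + P.card) _ ?_ ?_ ?_
      · simp only [pt_zero, pt_one, pt_two]; push_cast; ring
      · simp only [pt_zero, pt_one, pt_two]; omega
      · intro p q hpq hp hq hpq'
        simp only [pt_zero, pt_one, pt_two] at hp hq
        refine ⟨hpq, ?_, ?_⟩
        · simp only [box, Set.mem_ofPred_eq]; omega
        · rw [Set.empty_union]
          intro hqU
          have := hmin q (hU hqU)
          omega
    · exact adj_above (.inr rfl) c₀

theorem reach_corner (hmin : ∀ c ∈ P, c₀ 2 ≤ c 2) (hc : c₀ ∈ P) :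
    ∀ A ⊆ tiles P, Relation.ReflTransGen (CMove {p | p + (seed (scaledCopy 3 P).card - foot 1 c₀) ∈
      workspace (scaledCopy 3 P).card} A) (-(seed (scaledCopy 3 P).card - foot 1 c₀))
      (center (pt (c₀ 0 - (P.card + 1)) (c₀ 1 - (P.card + 1)) (c₀ 2 - (P.card + 1)))) := by
  intro A hA
  have hpos : 0 < P.card := Finset.card_pos.2 ⟨c₀, hc⟩
  -- With `m = P.card` and `27m` tiles, the differences of the coordinates are `24m - 3` twice and
  -- `24m - 2`, the last one because the foot is one below the center.
  refine reflTransGen_of_le (72 * P.card - 8) _ ?_ ?_ ?_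
  · simp only [center, seed, foot, Pi.neg_apply, Pi.sub_apply, pt_zero, pt_one, pt_two,
      card_scaledCopy]
    push_cast [show 8 ≤ 72 * P.card by omega]
    ring
  · simp only [center, seed, foot, Pi.neg_apply, Pi.sub_apply, pt_zero, pt_one, pt_two,
      card_scaledCopy]
    push_cast
    omega
  · intro p q hpq hp hq hpq'
    simp only [center, seed, foot, Pi.neg_apply, Pi.sub_apply, pt_zero, pt_one, pt_two,
      card_scaledCopy] at hp hq
    push_cast at hp hq
    refine Clear.move ?_ ?_ ?_ hpq
    · intro r hr hw
      obtain ⟨c, hc, hrc⟩ := mem_tiles.1 (hA hr)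
      have := hmin c hc
      unfold Within InCell at *
      omega
    all_goals
      simp only [Set.mem_ofPred_eq, workspace, seed, foot, Fin.forall_fin_succ,
        Pi.add_apply, Pi.sub_apply]
      simp only [Fin.succ_zero_eq_one, Fin.succ_one_eq_two, pt_zero, pt_one, pt_two,
        IsEmpty.forall_iff, and_true, card_scaledCopy]
      push_cast
      omega

end

end TiltAssembly

theorem mainTheorem3 (P : Finset TiltAssembly.Pos) (hP : TiltAssembly.IsPolycube P)
    (hnd : TiltAssembly.NonDegenerate P) :
    TiltAssembly.Constructible (TiltAssembly.scaledCopy 3 P) := by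
  obtain ⟨⟨c, hc⟩⟩ := hP.nonempty
  obtain ⟨c₀, hc₀, hmin⟩ := Finset.exists_min_image P (fun c => c 2) ⟨c, hc⟩
  have hb := TiltAssembly.solvable (TiltAssembly.world hP hnd hc₀ hmin) P 1 _ _ c₀ ∅ ∅
    {TiltAssembly.foot 1 c₀} (TiltAssembly.ctx hP hc₀ hmin) (by
      intro r hr
      rw [Finset.mem_singleton.1 hr, TiltAssembly.level_foot (.inl rfl), one_mul]
      exact ⟨TiltAssembly.inCell_foot (.inl rfl), rfl⟩) (Finset.mem_singleton_self _)
  rw [Finset.empty_union, Finset.empty_union] at hb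
  have h := hb.assembled (TiltAssembly.reach_corner hmin hc₀) (by
    rw [Finset.image_singleton, add_sub_cancel]
    exact .seed) subset_rfl
  -- The translation takes the foot of `c₀` to the seed; the extra `- 1` passes from corner-based to
  -- centered cubes.
  refine ⟨TiltAssembly.seed (TiltAssembly.scaledCopy 3 P).card - TiltAssembly.foot 1 c₀ - 1, ?_⟩
  convert h using 1
  ext p
  simp only [Finset.mem_image, TiltAssembly.mem_scaledCopy, TiltAssembly.mem_tiles]
  constructor
  · rintro ⟨q, hq, rfl⟩
    exact ⟨q - 1, hq, by abel⟩
  · rintro ⟨q, hq, rfl⟩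
    exact ⟨q + 1, by simpa using hq, by abel⟩
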